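/- Polynomial-time algorithms and provers are non-uniform: classical ones are polynomial-size randomized Boolean circuits, quantum ones polynomial-size quantum circuits. A function $\nu:\mathbb N\to\mathbb R_{\ge 0}$ is negligible if $\nu(\lambda)p(\lambda)\to 0$ for every polynomial $p$. A trapdoor claw-free (TCF) family consists of functions $f_k:\mathcal X_k\to\{0,1\}^{v}$ with $\mathcal X_k\subseteq\{0,1\}^n$, where $n=n(\lambda)$ and $v=v(\lambda)$, with: (1) an efficient probabilistic algorithm $\mathrm{Gen}(1^\lambda)$ that outputs a key and a trapdoor $(k,t_k)$; (2) for each generated $(k,t_k)$ a perfect matching $R_k$ of $\mathcal X_k$ with $f_k(x_0)=f_k(x_1)$ for all $(x_0,x_1)\in R_k$, and an efficient deterministic algorithm $\mathrm{Inv}$ with $\mathrm{Inv}(t_k,y)=(x_0,x_1)$ whenever $(x_0,x_1)\in R_k$ and $f_k(x_0)=f_k(x_1)=y$; (3) claw-freeness: every polynomial-time algorithm that is given $k$ outputs $(x_0,x_1)$ with $x_0,x_1\in\mathcal X_k$, $x_0\ne x_1$ and $f_k(x_0)=f_k(x_1)$ with at most negligible probability; (4) a polynomial-time quantum algorithm that,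 given $k$, prepares $|\mathcal X_k|^{-1/2}\sum_{x\in\mathcal X_k}|x\rangle|f_k(x)\rangle$ up to a negligible error. The family is classically (resp. quantumly) secure if (3) holds for classical (resp. quantum) algorithms. For $a,b\in\{0,1\}^n$ let $a\cdot b$ be the inner product modulo $2$. The simplified KCVY protocol for the family is as follows. (i) The verifier samples $(k,t_k)\leftarrow\mathrm{Gen}(1^\lambda)$ and sends $k$; the prover returns $y\in\{0,1\}^{v}$. (ii) The verifier sends uniformly random $r_0,r_1\in\{0,1\}^n$; the prover returns $d\in\{0,1\}^n$. (iii) The verifier sends a uniformly random $m\in\{0,1\}$; the prover returns $b\in\{0,1\}$. (iv) The verifier rejects if $y\notin f_k(\mathcal X_k)$. Otherwise it computes $(x_0,x_1)=\mathrm{Inv}(t_k,y)$ and accepts if and only if $(-1)^b=\hat c_m$, where $$\hat c_m=(1-\alpha)(-1)^{r_0\cdot x_0}+\alpha(-1)^{\beta}(-1)^m,\qquad \alpha=r_0\cdot x_0\oplus r_1\cdot x_1\in\{0,1\},\quad \beta=d\cdot(x_0\oplus x_1).$$ **Theorem 4 (Classical and quantum soundness of the simplified protocol).** If the TCF family is classically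 secure, then for every classical polynomial-time prover there is a negligible function $\nu$ such that for all $\lambda$ the prover is accepted with probability at most $\frac34+\nu(\lambda)$. If the TCF family is quantumly secure, then for every quantum polynomial-time prover there is a negligible function $\nu$ such that for all $\lambda$ the prover is accepted with probability at most $\cos^2\frac{\pi}{8}+\nu(\lambda)$. -/

import Mathlib

open Filter Topology

noncomputable section

/-- Bit strings of length `n`. -/
abbrev Bits (n : ℕ) : Type := Fin n → Bool

/-- A size function is bounded by a polynomial in the security parameter. -/
def PolyBounded (s : ℕ → ℕ) : Prop := ∃ p : Polynomial ℕ, ∀ l, s l ≤ p.eval l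

/-- Negligible functions: nonnegative, and tending to `0` even after multiplication by any
power (hence by any polynomial) of the security parameter. -/
def Negligible (f : ℕ → ℝ) : Prop :=
  (∀ l, 0 ≤ f l) ∧ Asymptotics.SuperpolynomialDecay atTop (fun l : ℕ => (l : ℝ)) f

/-! ## Classical circuits -/

/-- A Boolean gate of fan-in two on the wires `W`: the value of the wire `dst` is replaced by
`op` of the values of the wires `src₁` and `src₂`. -/
structure BoolGate (W : Type) where
  op : Bool → Bool → Bool
  src₁ : W
  src₂ : W
  dst : W

/-- The action of a Boolean gate on an assignment of the wires. -/
def BoolGate.apply {W : Type} [DecidableEq W] (g : BoolGate W) (s : W → Bool) : W → Bool :=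
  Function.update s g.dst (g.op (s g.src₁) (s g.src₂))

/-- The gates of the list are applied from left to right. -/
def runBool {W : Type} [DecidableEq W] (C : List (BoolGate W)) (s : W → Bool) : W → Bool :=
  C.foldl (fun s g => g.apply s) s

/-! ## Quantum circuits -/

/-- A vector on one qubit per wire in `W`, given by its amplitudes in the computational basis. -/
abbrev QVec (W : Type) : Type := (W → Bool) → ℂ

/-- An arbitrary unitary gate on an ordered pair of distinct qubits. -/
structure QGate (W : Type) where
  U : Matrix.unitaryGroup (Bool × Bool) ℂ
  fst : W
  snd : W
  ne : fst ≠ snd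

/-- The action of a gate on a vector: `U` on the qubits `fst`, `snd`, tensored with the identity
on all other qubits. -/
def QGate.apply {W : Type} [DecidableEq W] (g : QGate W) (ψ : QVec W) : QVec W := fun s =>
  ∑ v : Bool × Bool, g.U.1 (s g.fst, s g.snd) v *
    ψ (Function.update (Function.update s g.fst v.1) g.snd v.2)

/-- The gates of the list are applied from left to right. -/
def runQ {W : Type} [DecidableEq W] (C : List (QGate W)) (ψ : QVec W) : QVec W :=
  C.foldl (fun ψ g => g.apply ψ) ψ

/-- The computational basis vector `|s⟩`. -/
def ket {W : Type} [DecidableEq W] [Fintype W] (s : W → Bool) : QVec W :=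
  fun s' => if s' = s then 1 else 0

/-- Squared Euclidean norm. -/
def normSq {W : Type} [DecidableEq W] [Fintype W] (ψ : QVec W) : ℝ := ∑ s, ‖ψ s‖ ^ 2

/-- The unnormalized post-measurement vector: the projection of `ψ` on the basis vectors whose
restriction to the register `reg` is `v`. -/
def project {W J : Type} [DecidableEq J] [Fintype J] (reg : J → W) (v : J → Bool) (ψ : QVec W) :
    QVec W :=
  fun s => if (fun j => s (reg j)) = v then ψ s else 0

/-! ## Non-interactive algorithms -/

/-- The wires of an algorithm with input bits `I`, output bits `O` and work bits `T`. -/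
abbrev AlgWire (I O T : Type) : Type := I ⊕ (O ⊕ T)

/-- Initial assignment: the input `x`, zeros on the output wires, `c` on the work wires. -/
def algInit {I O T : Type} (x : I → Bool) (c : T → Bool) : AlgWire I O T → Bool :=
  Sum.elim x (Sum.elim (fun _ => false) c)

/-- The output register. -/
def algOut {I O T : Type} (o : O) : AlgWire I O T := Sum.inr (Sum.inl o)

/-- A randomized Boolean circuit with `coins` uniformly random bits and `work` zero bits. A
sequence of these of polynomial size is a non-uniform probabilistic polynomial-time algorithm. -/
structure ClassicalAlg (I O : Type) where
  coins : ℕ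
  work : ℕ
  circuit : List (BoolGate (AlgWire I O (Fin coins ⊕ Fin work)))

namespace ClassicalAlg

variable {I O : Type} [DecidableEq I] [Fintype I] [DecidableEq O] [Fintype O]

/-- Number of wires plus number of gates. -/
def size (A : ClassicalAlg I O) : ℕ :=
  Fintype.card (AlgWire I O (Fin A.coins ⊕ Fin A.work)) + A.circuit.length

/-- The output on input `x` and random coins `c`. -/
def eval (A : ClassicalAlg I O) (x : I → Bool) (c : Bits A.coins) : O → Bool := fun o =>
  runBool A.circuit (algInit x (Sum.elim c (fun _ => false))) (algOut o)

/-- The probability, over uniform coins, of the output `z` on input `x`. -/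
def prob (A : ClassicalAlg I O) (x : I → Bool) (z : O → Bool) : ℝ :=
  (∑ c : Bits A.coins, if A.eval x c = z then (1 : ℝ) else 0) / 2 ^ A.coins

end ClassicalAlg

/-- A quantum circuit with `work` ancilla qubits. A sequence of these of polynomial size is a
non-uniform quantum polynomial-time algorithm. -/
structure QuantumAlg (I O : Type) where
  work : ℕ
  circuit : List (QGate (AlgWire I O (Fin work)))

namespace QuantumAlg

variable {I O : Type} [DecidableEq I] [Fintype I] [DecidableEq O] [Fintype O]

/-- Number of qubits plus number of gates. -/
def size (A : QuantumAlg I O) : ℕ :=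
  Fintype.card (AlgWire I O (Fin A.work)) + A.circuit.length

/-- The final vector on input `x`, all other qubits being initially `|0⟩`. -/
def final (A : QuantumAlg I O) (x : I → Bool) : QVec (AlgWire I O (Fin A.work)) :=
  runQ A.circuit (ket (algInit x (fun _ => false)))

/-- The probability of the output `z` on input `x`, when the output register is measured. -/
def prob (A : QuantumAlg I O) (x : I → Bool) (z : O → Bool) : ℝ :=
  normSq (project algOut z (A.final x))

end QuantumAlg

/-! ## Trapdoor claw-free functions -/

/-- The data of a function family with trapdoors. For the security parameter `l`, keys,
trapdoors, function values and preimages are strings of lengths `keyLen l`, `tdLen l`, `imgLen l`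
and `inLen l`; the function with key `k` is `f l k`, and its domain `X_k` is `dom l k`. -/
structure FunFamily where
  keyLen : ℕ → ℕ
  tdLen : ℕ → ℕ
  imgLen : ℕ → ℕ
  inLen : ℕ → ℕ
  Gen : ∀ l, PMF (Bits (keyLen l) × Bits (tdLen l))
  dom : ∀ l, Bits (keyLen l) → Finset (Bits (inLen l))
  f : ∀ l, Bits (keyLen l) → Bits (inLen l) → Bits (imgLen l)
  Inv : ∀ l, Bits (tdLen l) → Bits (imgLen l) → Bits (inLen l) × Bits (inLen l)

/-- The kind of polynomial-time adversaries against which claw-freeness is required. -/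
inductive Security where
  | classical
  | quantum

namespace FunFamily

/-- The expectation of `g k t` when the key `k` and the trapdoor `t` are drawn by `Gen`. -/
def genAvg (F : FunFamily) (l : ℕ) (g : Bits (F.keyLen l) → Bits (F.tdLen l) → ℝ) : ℝ :=
  ∑ kt : Bits (F.keyLen l) × Bits (F.tdLen l), (F.Gen l kt).toReal * g kt.1 kt.2

/-- Efficient generation: `Gen` is the output distribution of a polynomial-size sequence of
randomized circuits. -/
def EfficientGen (F : FunFamily) : Prop :=
  ∃ A : ∀ l, ClassicalAlg Empty (Fin (F.keyLen l) ⊕ Fin (F.tdLen l)),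
    PolyBounded (fun l => (A l).size) ∧
    ∀ l k t, (F.Gen l (k, t)).toReal = (A l).prob Empty.elim (Sum.elim k t)

/-- `R` is a perfect matching of the finite set `X`, each edge being listed as one ordered pair. -/
def IsPerfectMatching {α : Type} (X : Finset α) (R : Set (α × α)) : Prop :=
  (∀ p ∈ R, p.1 ∈ X ∧ p.2 ∈ X ∧ p.1 ≠ p.2) ∧ ∀ x ∈ X, ∃! p, p ∈ R ∧ (x = p.1 ∨ x = p.2)

/-- For each generated key and trapdoor there is a perfect matching of the domain such that
matched points have the same value, and `Inv` recovers the matched pair from that value. -/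
def TrapdoorInjectivePair (F : FunFamily) : Prop :=
  ∀ l k t, (k, t) ∈ (F.Gen l).support →
    ∃ R : Set (Bits (F.inLen l) × Bits (F.inLen l)), IsPerfectMatching (F.dom l k) R ∧
      (∀ x₀ x₁, (x₀, x₁) ∈ R → F.f l k x₀ = F.f l k x₁) ∧
      ∀ y x₀ x₁, (x₀, x₁) ∈ R → F.f l k x₀ = y → F.f l k x₁ = y → F.Inv l t y = (x₀, x₁)

/-- `Inv` is computed by a polynomial-size sequence of deterministic circuits. -/
def EfficientInv (F : FunFamily) : Prop :=
  ∃ A : ∀ l, ClassicalAlg (Fin (F.tdLen l) ⊕ Fin (F.imgLen l))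
      (Fin (F.inLen l) ⊕ Fin (F.inLen l)),
    PolyBounded (fun l => (A l).size) ∧ (∀ l, (A l).coins = 0) ∧
    ∀ l t y c, (A l).eval (Sum.elim t y) c = Sum.elim (F.Inv l t y).1 (F.Inv l t y).2

/-- The state `|X|^(-1/2) ∑_{x ∈ X} |k⟩|x⟩|f_k(x)⟩|0⟩` on input, output and work registers. -/
def clawState (F : FunFamily) (l : ℕ) (k : Bits (F.keyLen l)) (w : ℕ) :
    QVec (AlgWire (Fin (F.keyLen l)) (Fin (F.inLen l) ⊕ Fin (F.imgLen l)) (Fin w)) := fun s =>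
  ((Real.sqrt ((F.dom l k).card : ℝ))⁻¹ : ℂ) *
    ∑ x ∈ F.dom l k, ket (Sum.elim k (Sum.elim (Sum.elim x (F.f l k x)) (fun _ => false))) s

/-- Efficient superposition: a polynomial-size sequence of quantum circuits prepares, on input
`k`, the uniform superposition of the pairs `(x, f_k(x))` up to a negligible error. -/
def EfficientSuperposition (F : FunFamily) : Prop :=
  ∃ A : ∀ l, QuantumAlg (Fin (F.keyLen l)) (Fin (F.inLen l) ⊕ Fin (F.imgLen l)),
    PolyBounded (fun l => (A l).size) ∧ ∃ ν : ℕ → ℝ, Negligible ν ∧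
      ∀ l k t, (k, t) ∈ (F.Gen l).support →
        normSq (fun s => (A l).final k s - F.clawState l k (A l).work s) ≤ ν l

/-- `(x₀, x₁)` is a claw of the function with key `k`. -/
def IsClaw (F : FunFamily) (l : ℕ) (k : Bits (F.keyLen l)) (x₀ x₁ : Bits (F.inLen l)) : Prop :=
  x₀ ∈ F.dom l k ∧ x₁ ∈ F.dom l k ∧ F.f l k x₀ = F.f l k x₁ ∧ x₀ ≠ x₁

open Classical in
/-- The probability of obtaining a claw when the key is drawn by `Gen` and `out k` is the
distribution of the pair output on the key `k`. -/
def clawProb (F : FunFamily) (l : ℕ)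
    (out : Bits (F.keyLen l) → (Fin (F.inLen l) ⊕ Fin (F.inLen l) → Bool) → ℝ) : ℝ :=
  F.genAvg l fun k _ => ∑ x₀ : Bits (F.inLen l), ∑ x₁ : Bits (F.inLen l),
    if F.IsClaw l k x₀ x₁ then out k (Sum.elim x₀ x₁) else 0

/-- No non-uniform polynomial-time algorithm (randomized or quantum, according to the first
argument) finds a claw from the key with more than negligible probability. -/
def ClawFree (F : FunFamily) : Security → Prop
  | .classical =>
    ∀ A : ∀ l, ClassicalAlg (Fin (F.keyLen l)) (Fin (F.inLen l) ⊕ Fin (F.inLen l)),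
      PolyBounded (fun l => (A l).size) → Negligible fun l => F.clawProb l (A l).prob
  | .quantum =>
    ∀ A : ∀ l, QuantumAlg (Fin (F.keyLen l)) (Fin (F.inLen l) ⊕ Fin (F.inLen l)),
      PolyBounded (fun l => (A l).size) → Negligible fun l => F.clawProb l (A l).prob

/-- Trapdoor claw-free function families, with claw-freeness against classical or against quantum
adversaries. Efficiency of the family is only required non-uniformly. -/
structure IsTCF (F : FunFamily) (sec : Security) : Prop where
  efficientGen : F.EfficientGen
  trapdoorInjectivePair : F.TrapdoorInjectivePair
  efficientInv : F.EfficientInv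
  clawFree : F.ClawFree sec
  efficientSuperposition : F.EfficientSuperposition

end FunFamily

/-! ## The verifier -/

/-- Inner product modulo two, as `0` or `1`. -/
def dot {n : ℕ} (x y : Bits n) : ℕ := (∑ i, if x i && y i then 1 else 0) % 2

/-- The correct answer `ĉ_m`, with `α = r₀·x₀ ⊕ r₁·x₁` and `β = d·(x₀ ⊕ x₁)`. -/
def cHat {n : ℕ} (x₀ x₁ r₀ r₁ d : Bits n) (m : Bool) : ℤ :=
  let α : ℕ := (dot r₀ x₀ + dot r₁ x₁) % 2
  let β : ℕ := dot d (fun i => xor (x₀ i) (x₁ i))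
  (1 - (α : ℤ)) * (-1) ^ dot r₀ x₀ + (α : ℤ) * (-1) ^ β * (-1) ^ m.toNat

namespace FunFamily

/-- The verifier's decision: `y` must be a value of `f_k` (otherwise the verifier rejects), and
`(-1)^b = ĉ_m` for the pair `(x₀, x₁) = Inv(t, y)`. -/
def Accepts (F : FunFamily) (l : ℕ) (k : Bits (F.keyLen l)) (t : Bits (F.tdLen l))
    (y : Bits (F.imgLen l)) (r₀ r₁ d : Bits (F.inLen l)) (m b : Bool) : Prop :=
  (∃ x ∈ F.dom l k, F.f l k x = y) ∧
    (-1 : ℤ) ^ b.toNat = cHat (F.Inv l t y).1 (F.Inv l t y).2 r₀ r₁ d m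

open Classical in
/-- The acceptance probability, when `resp k r₀ r₁ m y d b` is the probability that the prover's
three messages are `y, d, b` if the verifier's messages are `k`, `(r₀, r₁)` and `m`. The verifier
draws `(k, t)` by `Gen`, and `r₀, r₁, m` uniformly. -/
def acceptProb (F : FunFamily) (l : ℕ)
    (resp : Bits (F.keyLen l) → Bits (F.inLen l) → Bits (F.inLen l) → Bool →
      Bits (F.imgLen l) → Bits (F.inLen l) → Bool → ℝ) : ℝ :=
  F.genAvg l fun k t =>
    (∑ r₀ : Bits (F.inLen l), ∑ r₁ : Bits (F.inLen l), ∑ m : Bool,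
      ∑ y : Bits (F.imgLen l), ∑ d : Bits (F.inLen l), ∑ b : Bool,
        if F.Accepts l k t y r₀ r₁ d m b then resp k r₀ r₁ m y d b else 0) /
      (2 ^ F.inLen l * 2 ^ F.inLen l * 2)

end FunFamily

/-! ## Provers -/

/-- The wires of a prover: one register for each message of the protocol (`a`, `v`, `n` are the
lengths of keys, of function values and of preimages) and a workspace `T`. -/
inductive ProverWire (a v n : ℕ) (T : Type) where
  | key (i : Fin a)
  | img (i : Fin v)
  | r₀ (i : Fin n)
  | r₁ (i : Fin n)
  | d (i : Fin n)
  | chal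
  | ans
  | work (j : T)
  deriving DecidableEq, Fintype

namespace ProverWire

variable {a v n : ℕ} {T : Type}

/-- Initial assignment: the key, `c` on the workspace, zeros elsewhere. -/
def init (k : Bits a) (c : T → Bool) : ProverWire a v n T → Bool
  | .key i => k i
  | .work j => c j
  | _ => false

/-- The arrival of the second message `(r₀, r₁)`: it is added bitwise to its register. -/
def loadR (x₀ x₁ : Bits n) (s : ProverWire a v n T → Bool) : ProverWire a v n T → Bool
  | .r₀ i => xor (s (.r₀ i)) (x₀ i)
  | .r₁ i => xor (s (.r₁ i)) (x₁ i)
  | j => s j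

/-- The arrival of the challenge `m`: it is added to its register. -/
def loadM (m : Bool) (s : ProverWire a v n T → Bool) : ProverWire a v n T → Bool
  | .chal => xor (s .chal) m
  | j => s j

end ProverWire

/-- A classical prover: a randomized Boolean circuit for each of the three rounds. The
assignment of all wires, random coins included, is carried over from one round to the next. -/
structure ClassicalProver (a v n : ℕ) where
  coins : ℕ
  work : ℕ
  round₁ : List (BoolGate (ProverWire a v n (Fin coins ⊕ Fin work)))
  round₂ : List (BoolGate (ProverWire a v n (Fin coins ⊕ Fin work)))
  round₃ : List (BoolGate (ProverWire a v n (Fin coins ⊕ Fin work)))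

namespace ClassicalProver

variable {a v n : ℕ}

/-- Number of wires plus number of gates. -/
def size (P : ClassicalProver a v n) : ℕ :=
  Fintype.card (ProverWire a v n (Fin P.coins ⊕ Fin P.work)) +
    (P.round₁.length + P.round₂.length + P.round₃.length)

/-- The assignment after the first round, on key `k` and coins `c`. -/
def state₁ (P : ClassicalProver a v n) (k : Bits a) (c : Bits P.coins) :
    ProverWire a v n (Fin P.coins ⊕ Fin P.work) → Bool :=
  runBool P.round₁ (ProverWire.init k (Sum.elim c (fun _ => false)))

/-- The assignment after the second round. -/
def state₂ (P : ClassicalProver a v n) (k : Bits a) (r₀ r₁ : Bits n) (c : Bits P.coins) :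
    ProverWire a v n (Fin P.coins ⊕ Fin P.work) → Bool :=
  runBool P.round₂ (ProverWire.loadR r₀ r₁ (P.state₁ k c))

/-- The assignment after the third round. -/
def state₃ (P : ClassicalProver a v n) (k : Bits a) (r₀ r₁ : Bits n) (m : Bool)
    (c : Bits P.coins) : ProverWire a v n (Fin P.coins ⊕ Fin P.work) → Bool :=
  runBool P.round₃ (ProverWire.loadM m (P.state₂ k r₀ r₁ c))

/-- The probability, over uniform coins, that the prover's messages are `y, d, b`. -/
def resp (P : ClassicalProver a v n) (k : Bits a) (r₀ r₁ : Bits n) (m : Bool)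
    (y : Bits v) (d : Bits n) (b : Bool) : ℝ :=
  (∑ c : Bits P.coins,
    if (fun i => P.state₁ k c (.img i)) = y ∧ (fun i => P.state₂ k r₀ r₁ c (.d i)) = d ∧
        P.state₃ k r₀ r₁ m c .ans = b
      then (1 : ℝ) else 0) / 2 ^ P.coins

end ClassicalProver

/-- A quantum prover: a quantum circuit for each of the three rounds, with `work` ancilla
qubits. After each round the register of the prover's message is measured, and the
post-measurement state is carried over to the next round. -/
structure QuantumProver (a v n : ℕ) where
  work : ℕ
  round₁ : List (QGate (ProverWire a v n (Fin work)))
  round₂ : List (QGate (ProverWire a v n (Fin work)))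
  round₃ : List (QGate (ProverWire a v n (Fin work)))

namespace QuantumProver

variable {a v n : ℕ}

/-- Number of qubits plus number of gates. -/
def size (P : QuantumProver a v n) : ℕ :=
  Fintype.card (ProverWire a v n (Fin P.work)) +
    (P.round₁.length + P.round₂.length + P.round₃.length)

/-- The unnormalized state after the first round and the measurement outcome `y`. -/
def state₁ (P : QuantumProver a v n) (k : Bits a) (y : Bits v) :
    QVec (ProverWire a v n (Fin P.work)) :=
  project ProverWire.img y (runQ P.round₁ (ket (ProverWire.init k (fun _ => false))))

/-- The unnormalized state after the second round and the outcomes `y, d`. The bitwise addition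
of `(r₀, r₁)` is an involution of the basis vectors. -/
def state₂ (P : QuantumProver a v n) (k : Bits a) (r₀ r₁ : Bits n) (y : Bits v) (d : Bits n) :
    QVec (ProverWire a v n (Fin P.work)) :=
  project ProverWire.d d
    (runQ P.round₂ (fun s => P.state₁ k y (ProverWire.loadR r₀ r₁ s)))

/-- The unnormalized state after the third round and the outcomes `y, d, b`. -/
def state₃ (P : QuantumProver a v n) (k : Bits a) (r₀ r₁ : Bits n) (m : Bool)
    (y : Bits v) (d : Bits n) (b : Bool) : QVec (ProverWire a v n (Fin P.work)) :=
  project (fun _ : Unit => ProverWire.ans) (fun _ => b)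
    (runQ P.round₃ (fun s => P.state₂ k r₀ r₁ y d (ProverWire.loadM m s)))

/-- The probability that the prover's messages are `y, d, b`. -/
def resp (P : QuantumProver a v n) (k : Bits a) (r₀ r₁ : Bits n) (m : Bool)
    (y : Bits v) (d : Bits n) (b : Bool) : ℝ :=
  normSq (P.state₃ k r₀ r₁ m y d b)

end QuantumProver

end

/-! Fix a valid `y` with claw `(x₀, x₁) = Inv(t, y)`. For given `r₀, r₁, d` exactly one answer `c m`
is accepted for each challenge: it is `r₀·x₀` for both challenges if `α = 0`, and `β ⊕ m` if `α =
1`. Hence `c 0 ⊕ c 1 = α`, the inner product of `(r₀, r₁)` with the concatenation of `x₀` and `x₁`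
(`exists_correct_answer`). A prover that answers both challenges well thus predicts a random parity
of the claw, and such a predictor yields the claw itself, against claw-freeness.

Classical case. With fixed coins the prover can be rewound, and the sum of its two answers is a
guess for `α`. A wrong guess means that exactly one challenge is answered correctly, so acceptance
is at most `3/4` plus a quarter of the bias of the guess (`acceptProb_classical_le`). The
Goldreich-Levin decoder turns this bias into a claw: `t` random seeds, with guessed parities, give
`2 ^ t` uncorrelated query points, and a majority vote recovers every bit (`le_sum_decode`). Since
`2 ^ t` is polynomial, guessing the `t` parities costs only a polynomial factor. Straight-line
programs (`Reaches`, `Cost`) bound the circuit size of the decoder.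

Quantum case. The answer to challenge `m` is a `±1`-valued observable `O_m`. Expanding `‖√2 φ -
(±O₀φ) - (±O₁φ)‖² ≥ 0` bounds acceptance by `1/2 + √2/4 = cos²(π/8)` plus a multiple of the
correlation of `Re ⟨O₀φ, O₁φ⟩` with the sign `(-1)^α` (`sum_normSq_correct_le`,
`acceptProb_quantum_le`). To exploit that correlation, prepare `(r₀, r₁)` in uniform superposition,
run two rounds, apply `O₀⁻¹O₁`, undo the second round and apply Hadamard gates, as in the
Bernstein-Vazirani algorithm. The inner product of the prover's state after the message `y` with the
component carrying the claw is exactly the averaged correlation (`ip_state₁_extracted`), so the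
square of the advantage is at most the probability of a claw (`exists_alg_sq_quantumAdvantage_le`).
-/

/-! ## Polynomially bounded and negligible functions -/

namespace PolyBounded

theorem const (c : ℕ) : PolyBounded fun _ => c := ⟨Polynomial.C c, fun l => by simp⟩

theorem id : PolyBounded fun l => l := ⟨Polynomial.X, fun l => by simp⟩

theorem mono {s t : ℕ → ℕ} (ht : PolyBounded t) (h : ∀ l, s l ≤ t l) : PolyBounded s := by
  obtain ⟨p, hp⟩ := ht
  exact ⟨p, fun l => (h l).trans (hp l)⟩

theorem add {s t : ℕ → ℕ} (hs : PolyBounded s) (ht : PolyBounded t) :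
    PolyBounded fun l => s l + t l := by
  obtain ⟨p, hp⟩ := hs
  obtain ⟨q, hq⟩ := ht
  exact ⟨p + q, fun l => by simpa using add_le_add (hp l) (hq l)⟩

theorem mul {s t : ℕ → ℕ} (hs : PolyBounded s) (ht : PolyBounded t) :
    PolyBounded fun l => s l * t l := by
  obtain ⟨p, hp⟩ := hs
  obtain ⟨q, hq⟩ := ht
  exact ⟨p * q, fun l => by simpa using Nat.mul_le_mul (hp l) (hq l)⟩

theorem pow {s : ℕ → ℕ} (hs : PolyBounded s) (q : ℕ) : PolyBounded fun l => s l ^ q := by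
  obtain ⟨p, hp⟩ := hs
  exact ⟨p ^ q, fun l => by simpa using Nat.pow_le_pow_left (hp l) q⟩

end PolyBounded

namespace Negligible

theorem polyBounded_mul {M : ℕ → ℕ} {f : ℕ → ℝ} (hM : PolyBounded M) (hf : Negligible f) :
    Negligible fun l => M l * f l := by
  obtain ⟨p, hp⟩ := hM
  refine ⟨fun l => mul_nonneg (Nat.cast_nonneg _) (hf.1 l), ?_⟩
  have h := hf.2.polynomial_mul (p.map (Nat.castRingHom ℝ))
  intro n
  have h' := h n
  refine squeeze_zero (fun l => ?_) (fun l => ?_) h'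
  · have := hf.1 l
    positivity
  · have h1 : ((M l : ℕ) : ℝ) ≤ (p.map (Nat.castRingHom ℝ)).eval (l : ℝ) := by
      rw [Polynomial.eval_natCast_map]
      simpa using (Nat.cast_le (α := ℝ)).2 (hp l)
    exact mul_le_mul_of_nonneg_left (mul_le_mul_of_nonneg_right h1 (hf.1 l)) (by positivity)

theorem const_mul {f : ℕ → ℝ} (hf : Negligible f) {c : ℝ} (hc : 0 ≤ c) :
    Negligible fun l => c * f l :=
  ⟨fun l => mul_nonneg hc (hf.1 l), hf.2.const_mul c⟩

theorem of_sq_le {f g : ℕ → ℝ} (hg : Negligible g) (hf : ∀ l, 0 ≤ f l)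
    (h : ∀ l, f l ^ 2 ≤ g l) : Negligible f := by
  refine ⟨hf, fun n => ?_⟩
  have h1 := hg.2 (2 * n)
  have h2 := (Real.continuous_sqrt.tendsto _).comp h1
  rw [Real.sqrt_zero] at h2
  refine squeeze_zero (fun l => mul_nonneg (by positivity) (hf l)) (fun l => ?_) h2
  refine Real.le_sqrt_of_sq_le ?_
  calc ((l : ℝ) ^ n * f l) ^ 2 = (l : ℝ) ^ (2 * n) * f l ^ 2 := by ring
    _ ≤ _ := mul_le_mul_of_nonneg_left (h l) (by positivity)

/-- Meant for reductions whose adversary depends on the desired accuracy: each `q` has its own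
adversary and its own negligible error `g`. The exponent `n + 1` leaves a spare factor `1/(l+1)`
after multiplication by `l ^ n`. -/
theorem of_le_inv_pow_add {f : ℕ → ℝ} (hf : ∀ l, 0 ≤ f l)
    (h : ∀ q : ℕ, ∃ g : ℕ → ℝ, Negligible g ∧ ∀ l, f l ≤ ((l : ℝ) + 1)⁻¹ ^ q + g l) :
    Negligible f := by
  refine ⟨hf, fun n => ?_⟩
  obtain ⟨g, hg, hle⟩ := h (n + 1)
  have h1 := (tendsto_one_div_add_atTop_nhds_zero_nat (𝕜 := ℝ)).add (hg.2 n)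
  rw [add_zero] at h1
  refine squeeze_zero (fun l => mul_nonneg (by positivity) (hf l)) (fun l => ?_) h1
  calc (l : ℝ) ^ n * f l ≤ (l : ℝ) ^ n * (((l : ℝ) + 1)⁻¹ ^ (n + 1) + g l) :=
        mul_le_mul_of_nonneg_left (hle l) (by positivity)
    _ = ((l : ℝ) * ((l : ℝ) + 1)⁻¹) ^ n * ((l : ℝ) + 1)⁻¹ + (l : ℝ) ^ n * g l := by ring
    _ ≤ 1 * ((l : ℝ) + 1)⁻¹ + (l : ℝ) ^ n * g l := by
        have h2 : (l : ℝ) * ((l : ℝ) + 1)⁻¹ ≤ 1 := by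
          rw [← div_eq_mul_inv]
          exact div_le_one_of_le₀ (by linarith) (by positivity)
        gcongr
        exact pow_le_one₀ (by positivity) h2
    _ = _ := by rw [one_mul, one_div]

end Negligible

/-! ## Signs and characters -/

/-- The sign `(-1)^b`. -/
def bsign (b : Bool) : ℝ := if b then -1 else 1

@[simp] theorem bsign_true : bsign true = -1 := rfl

@[simp] theorem bsign_false : bsign false = 1 := rfl

theorem bsign_xor (a b : Bool) : bsign (xor a b) = bsign a * bsign b := by
  cases a <;> cases b <;> norm_num [bsign]

theorem bsign_mul_self (a : Bool) : bsign a * bsign a = 1 := by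
  cases a <;> norm_num [bsign]

theorem abs_bsign (a : Bool) : |bsign a| = 1 := by
  cases a <;> norm_num [bsign]

/-- The character `(-1)^(r·x)` of the group of bit strings. -/
def parityChar {R : Type*} [Fintype R] (r x : R → Bool) : ℝ := ∏ i, bsign (r i && x i)

theorem parityChar_xor {R : Type*} [Fintype R] (r s x : R → Bool) :
    parityChar (fun i => xor (r i) (s i)) x = parityChar r x * parityChar s x := by
  simp only [parityChar, ← Finset.prod_mul_distrib, ← bsign_xor]
  refine Finset.prod_congr rfl fun i _ => ?_
  cases r i <;> cases s i <;> cases x i <;> rfl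

theorem parityChar_single {R : Type*} [Fintype R] [DecidableEq R] (i : R) (x : R → Bool) :
    parityChar (fun j => decide (j = i)) x = bsign (x i) := by
  rw [parityChar, Finset.prod_eq_single i]
  · simp
  · intro j _ hj
    simp [hj]
  · simp

theorem parityChar_sum {R S : Type*} [Fintype R] [Fintype S] (r x : R → Bool) (s y : S → Bool) :
    parityChar (Sum.elim r s) (Sum.elim x y) = parityChar r x * parityChar s y := by
  simp [parityChar, Fintype.prod_sum_type]

/-- The parity `r·x` as a bit. -/
noncomputable def parityBit {R : Type*} [Fintype R] (r x : R → Bool) : Bool := decide (parityChar r x = -1)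

theorem parityChar_eq_or {R : Type*} [Fintype R] (r x : R → Bool) :
    parityChar r x = 1 ∨ parityChar r x = -1 := by
  unfold parityChar
  refine Finset.prod_induction _ (fun t => t = 1 ∨ t = -1) ?_ (Or.inl rfl) ?_
  · rintro a b (rfl | rfl) (rfl | rfl) <;> norm_num
  · intro i _
    cases (r i && x i) <;> norm_num

theorem bsign_parityBit {R : Type*} [Fintype R] (r x : R → Bool) :
    bsign (parityBit r x) = parityChar r x := by
  rcases parityChar_eq_or r x with h | h <;> norm_num [parityBit, h, bsign]

theorem abs_parityChar {R : Type*} [Fintype R] (r x : R → Bool) : |parityChar r x| = 1 := by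
  rw [← bsign_parityBit, abs_bsign]

theorem neg_one_pow_dot {n : ℕ} (x y : Bits n) : (-1 : ℝ) ^ dot x y = parityChar x y := by
  have h : ∀ m : ℕ, (-1 : ℝ) ^ (m % 2) = (-1) ^ m := fun m => by
    conv_rhs => rw [← Nat.div_add_mod m 2, pow_add, pow_mul]
    norm_num
  rw [dot, h, ← Finset.prod_pow_eq_pow_sum, parityChar]
  refine Finset.prod_congr rfl fun i _ => ?_
  cases (x i && y i) <;> norm_num

theorem dot_lt_two {n : ℕ} (x y : Bits n) : dot x y < 2 := Nat.mod_lt _ two_pos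

/-! ## The verifier's decision -/

/-- The answers accepted by the verifier are given by a function `c` of the challenge, and
`c 0 ⊕ c 1` is the parity `r₀·x₀ ⊕ r₁·x₁`. -/
theorem exists_correct_answer {n : ℕ} (x₀ x₁ r₀ r₁ d : Bits n) :
    ∃ c : Bool → Bool, (∀ m b, (-1 : ℤ) ^ b.toNat = cHat x₀ x₁ r₀ r₁ d m ↔ b = c m) ∧
      bsign (xor (c false) (c true)) = parityChar (Sum.elim r₀ r₁) (Sum.elim x₀ x₁) := by
  have hs := parityChar_sum r₀ x₀ r₁ x₁
  rw [← neg_one_pow_dot, ← neg_one_pow_dot] at hs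
  rw [hs]
  unfold cHat
  have h0 := dot_lt_two r₀ x₀
  have h1 := dot_lt_two r₁ x₁
  have hb := dot_lt_two d (fun i => xor (x₀ i) (x₁ i))
  generalize dot r₀ x₀ = u at *
  generalize dot r₁ x₁ = v at *
  generalize dot d (fun i => xor (x₀ i) (x₁ i)) = w at *
  -- Here `u = r₀·x₀`, `v = r₁·x₁` and `w = β`; the answer is `u` if `α = 0`, and `w ⊕ m` if `α =
  -- 1`.
  refine ⟨fun m => if (u + v) % 2 = 0 then decide (u = 1) else xor (decide (w = 1)) m, ?_, ?_⟩
  · intro m b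
    interval_cases u <;> interval_cases v <;> interval_cases w <;> cases m <;> cases b <;> decide
  · interval_cases u <;> interval_cases v <;> interval_cases w <;> norm_num [bsign]

namespace FunFamily

/-- A preimage of `y` in the domain lies on an edge of the matching, and `Inv` returns that edge. So
recovering the pair computed by the verifier is the same as breaking claw-freeness on this key. -/
theorem isClaw_inv {F : FunFamily} (hF : F.TrapdoorInjectivePair) {l : ℕ}
    {k : Bits (F.keyLen l)} {t : Bits (F.tdLen l)} (hkt : (k, t) ∈ (F.Gen l).support)
    {y : Bits (F.imgLen l)} (hy : ∃ x ∈ F.dom l k, F.f l k x = y) :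
    F.IsClaw l k (F.Inv l t y).1 (F.Inv l t y).2 := by
  obtain ⟨R, hR, hval, hinv⟩ := hF l k t hkt
  obtain ⟨x, hx, rfl⟩ := hy
  obtain ⟨⟨x₀, x₁⟩, ⟨hp, hxp⟩, -⟩ := hR.2 x hx
  have h01 := hval _ _ hp
  obtain ⟨h0, h1, hne⟩ := hR.1 _ hp
  have : F.Inv l t (F.f l k x) = (x₀, x₁) := by
    rcases hxp with rfl | rfl
    · exact hinv _ _ _ hp rfl h01.symm
    · exact hinv _ _ _ hp h01 rfl
  rw [this]
  exact ⟨h0, h1, h01, hne⟩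

theorem sum_gen (F : FunFamily) (l : ℕ) : ∑ kt, (F.Gen l kt).toReal = 1 := by
  rw [← ENNReal.toReal_sum fun kt _ => PMF.apply_ne_top _ _, ← tsum_fintype (L := .unconditional _),
    PMF.tsum_coe, ENNReal.toReal_one]

/-- Only generated keys matter, because the trapdoor properties are guaranteed for no others. -/
theorem genAvg_mono (F : FunFamily) {l : ℕ} {g h : Bits (F.keyLen l) → Bits (F.tdLen l) → ℝ}
    (hgh : ∀ k t, (k, t) ∈ (F.Gen l).support → g k t ≤ h k t) : F.genAvg l g ≤ F.genAvg l h := by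
  refine Finset.sum_le_sum fun kt _ => ?_
  by_cases hkt : kt ∈ (F.Gen l).support
  · exact mul_le_mul_of_nonneg_left (hgh kt.1 kt.2 hkt) ENNReal.toReal_nonneg
  · rw [PMF.mem_support_iff, not_not] at hkt
    simp [hkt]

theorem genAvg_const (F : FunFamily) (l : ℕ) (c : ℝ) : F.genAvg l (fun _ _ => c) = c := by
  rw [genAvg, ← Finset.sum_mul, sum_gen, one_mul]

theorem genAvg_add (F : FunFamily) (l : ℕ) (g h : Bits (F.keyLen l) → Bits (F.tdLen l) → ℝ) :
    F.genAvg l (fun k t => g k t + h k t) = F.genAvg l g + F.genAvg l h := by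
  simp [genAvg, mul_add, Finset.sum_add_distrib]

theorem genAvg_const_mul (F : FunFamily) (l : ℕ) (c : ℝ)
    (g : Bits (F.keyLen l) → Bits (F.tdLen l) → ℝ) :
    F.genAvg l (fun k t => c * g k t) = c * F.genAvg l g := by
  rw [genAvg, genAvg, Finset.mul_sum]
  exact Finset.sum_congr rfl fun kt _ => by ring

end FunFamily

/-! ## Straight-line programs -/

/-- `Reaches s A B`: a straight-line program with at most `s` binary gates extends the set `A` of
available Boolean functions to the set `B`. -/
inductive Reaches {X : Type*} : ℕ → Set (X → Bool) → Set (X → Bool) → Prop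
  | refl (s : ℕ) (A : Set (X → Bool)) : Reaches s A A
  | gate {s : ℕ} {A B : Set (X → Bool)} (h : Reaches s A B) (op : Bool → Bool → Bool)
      {f g : X → Bool} (hf : f ∈ B) (hg : g ∈ B) :
      Reaches (s + 1) A (insert (fun x => op (f x) (g x)) B)

namespace Reaches

variable {X : Type*} {A B C : Set (X → Bool)} {s t : ℕ}

theorem subset (h : Reaches s A B) : A ⊆ B := by
  induction h with
  | refl => exact subset_rfl
  | gate h op hf hg ih => exact ih.trans (Set.subset_insert _ _)

theorem mono (h : Reaches s A B) (hst : s ≤ t) : Reaches t A B := by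
  induction h generalizing t with
  | refl => exact .refl _ _
  | gate h op hf hg ih =>
    obtain ⟨t, rfl⟩ : ∃ t', t = t' + 1 := ⟨t - 1, by omega⟩
    exact .gate (ih (by omega)) op hf hg

theorem trans (h : Reaches s A B) (h' : Reaches t B C) : Reaches (s + t) A C := by
  induction h' with
  | refl => exact h.mono (by omega)
  | gate h' op hf hg ih => exact .gate (ih h) op hf hg

end Reaches

/-- The functions in `T` can be computed with `s` gates from those in `A`. -/
def Cost {X : Type*} (A : Set (X → Bool)) (s : ℕ) (T : Set (X → Bool)) : Prop :=
  -- Quantifying over all larger `B` makes costs compose: functions computed earlier for another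
  -- purpose stay available.
  ∀ B, A ⊆ B → ∃ C, Reaches s B C ∧ T ⊆ C

namespace Cost

variable {X : Type*} {A A' T T' : Set (X → Bool)} {s s' : ℕ}

theorem of_subset (h : T ⊆ A) : Cost A s T := fun B hB => ⟨B, .refl _ _, h.trans hB⟩

theorem mono (h : Cost A s T) (hA : A ⊆ A') (hs : s ≤ s') (hT : T' ⊆ T) : Cost A' s' T' := by
  intro B hB
  obtain ⟨C, hC, hTC⟩ := h B (hA.trans hB)
  exact ⟨C, hC.mono hs, hT.trans hTC⟩

theorem mono_nat (h : Cost A s T) (hs : s ≤ s') : Cost A s' T := h.mono subset_rfl hs subset_rfl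

theorem trans (h : Cost A s T) (h' : Cost (A ∪ T) s' T') : Cost A (s + s') T' := by
  intro B hB
  obtain ⟨C, hC, hTC⟩ := h B hB
  obtain ⟨D, hD, hTD⟩ := h' C (Set.union_subset (hB.trans hC.subset) hTC)
  exact ⟨D, hC.trans hD, hTD⟩

theorem union (h : Cost A s T) (h' : Cost A s' T') : Cost A (s + s') (T ∪ T') := by
  intro B hB
  obtain ⟨C, hC, hTC⟩ := h B hB
  obtain ⟨D, hD, hTD⟩ := h' C (hB.trans hC.subset)
  exact ⟨D, hC.trans hD, Set.union_subset (hTC.trans hD.subset) hTD⟩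

theorem gate {f g : X → Bool} (op : Bool → Bool → Bool) (hf : f ∈ A) (hg : g ∈ A) :
    Cost A 1 {fun x => op (f x) (g x)} :=
  fun B hB => ⟨_, .gate (.refl 0 B) op (hB hf) (hB hg), by simp⟩

theorem finset {ι : Type*} (I : Finset ι) (T : ι → Set (X → Bool)) (h : ∀ i ∈ I, Cost A s (T i)) :
    Cost A (I.card * s) (⋃ i ∈ I, T i) := by
  classical
  induction I using Finset.induction_on with
  | empty => exact of_subset (by simp)
  | insert i I hi ih =>
    rw [Finset.card_insert_of_notMem hi, Finset.set_biUnion_insert, Nat.succ_mul, Nat.add_comm]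
    exact (h i (by simp)).union (ih fun j hj => h j (by simp [hj]))

theorem family {ι : Type*} [Fintype ι] (f : ι → X → Bool) (h : ∀ i, Cost A s {f i}) :
    Cost A (Fintype.card ι * s) (Set.range f) :=
  (finset Finset.univ (fun i => {f i}) fun i _ => h i).mono subset_rfl le_rfl (by
    rintro _ ⟨i, rfl⟩
    simp)

/-- A circuit overwrites its wires while a program forgets nothing, so each circuit gate costs one
program gate: the wire `dst` then denotes the new function and all other wires denote old ones. -/
theorem runBool {W : Type} [DecidableEq W] (C : List (BoolGate W)) (σ : X → W → Bool)
    (h : ∀ w, (fun x => σ x w) ∈ A) :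
    Cost A C.length (Set.range fun w x => _root_.runBool C (σ x) w) := by
  induction C generalizing A σ with
  | nil => exact of_subset (by rintro _ ⟨w, rfl⟩; exact h w)
  | cons g C ih =>
    rw [List.length_cons, Nat.add_comm]
    refine (gate g.op (h g.src₁) (h g.src₂)).trans (ih (fun x => g.apply (σ x)) fun w => ?_)
    by_cases hw : w = g.dst
    · subst hw
      right
      simp [BoolGate.apply]
    · left
      simpa [BoolGate.apply, hw] using h w

/-- Parities of subfamilies. -/
theorem xorFold {ι : Type*} (v : ι → X → Bool) (hv : ∀ i, v i ∈ A) (hA : (fun _ => false) ∈ A)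
    (l : List ι) : Cost A l.length {fun x => l.foldr (fun i b => xor (v i x) b) false} := by
  induction l with
  | nil => exact of_subset (by simpa using hA)
  | cons i l ih => exact ih.trans (gate xor (Or.inl (hv i)) (Or.inr rfl))

/-- Threshold functions. -/
theorem threshold (K : ℕ) (l : List (X → Bool)) (hl : ∀ v ∈ l, v ∈ A)
    (hA : (fun _ => false) ∈ A) :
    Cost A ((K + 1) + l.length * ((K + 1) * 2))
      (Set.range fun (j : Fin (K + 1)) x => decide ((j : ℕ) ≤ l.countP fun v => v x)) := by
  induction l with
  | nil =>
    refine Cost.mono (family (s := 1) _ fun j => ?_) subset_rfl (by simp) subset_rfl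
    exact gate (fun _ _ => decide ((j : ℕ) ≤ 0)) hA hA
  | cons v l ih =>
    have ih := ih fun w hw => hl w (List.mem_cons_of_mem _ hw)
    rw [List.length_cons, Nat.succ_mul, ← Nat.add_assoc]
    refine ih.trans (Cost.mono (family (s := 2) _ fun j => ?_) subset_rfl (by simp) subset_rfl)
    have hv := hl v List.mem_cons_self
    obtain ⟨j, hj⟩ := j
    cases j with
    | zero =>
      refine Cost.mono (gate (fun _ _ => true) (Or.inl hA) (Or.inl hA)) subset_rfl (by omega) ?_
      simp
    | succ j =>
      -- At least `j + 1` of `v :: l` hold iff `v` holds together with at least `j` of `l`, or at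
      -- least `j + 1` of `l` hold. This costs two gates per threshold.
      refine (gate (g := fun x => decide (j ≤ l.countP fun v => v x)) (fun a b => a && b)
        (Or.inl hv) (Or.inr ⟨⟨j, by omega⟩, rfl⟩)).trans ((gate
          (g := fun x => decide (j + 1 ≤ l.countP fun v => v x)) (fun a b => a || b) (Or.inr rfl)
          (Or.inl (Or.inr ⟨⟨j + 1, hj⟩, rfl⟩))).mono subset_rfl le_rfl ?_)
      rintro _ rfl
      refine Set.mem_singleton_iff.2 (funext fun x => ?_)
      simp only [List.countP_cons]
      cases v x
      · simp
      · simp only [Bool.true_and, if_true, ← Bool.decide_or]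
        congr 1
        simp only [eq_iff_iff]
        omega

end Cost

/-! ## Realization of straight-line programs by circuits -/

/-- The bits of the input and of the coins, and the constant zero. -/
def basicFunctions (I K : Type) : Set ((I → Bool) × (K → Bool) → Bool) :=
  insert (fun _ => false) (Set.range fun (j : I ⊕ K) ω => Sum.elim ω.1 ω.2 j)

section Realize

variable {I O : Type} [DecidableEq I] [DecidableEq O]

theorem runBool_append {W : Type} [DecidableEq W] (C D : List (BoolGate W)) (s : W → Bool) :
    runBool (C ++ D) s = runBool D (runBool C s) := by
  simp [runBool]

/-- Every gate writes to a fresh work wire: wire `0` keeps the constant zero, and a program of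
budget `s` uses only wires up to `s`. The conditions on `j` keep stored functions off the output
wires and off the wires still to be written. -/
theorem Reaches.exists_circuit {K : Type} {c w s : ℕ} (e : K ≃ Fin c)
    {B : Set ((I → Bool) × (K → Bool) → Bool)}
    (h : Reaches s (basicFunctions I K) B) (hs : s < w) :
    ∃ C : List (BoolGate (AlgWire I O (Fin c ⊕ Fin w))), C.length ≤ s ∧
      ∀ f ∈ B, ∃ j, (∀ o, j ≠ algOut o) ∧ (∀ a : Fin w, s < a → j ≠ Sum.inr (Sum.inr (Sum.inr a))) ∧
        ∀ x r, runBool C (algInit x (Sum.elim (r ∘ e.symm) (fun _ => false))) j = f (x, r) := by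
  generalize hA : basicFunctions I K = A at h
  induction h with
  | refl =>
    subst hA
    refine ⟨[], by simp, ?_⟩
    rintro f (rfl | ⟨i | i, rfl⟩)
    rotate_left
    · exact ⟨Sum.inl i, by simp [algOut], by simp, fun x r => rfl⟩
    · exact ⟨Sum.inr (Sum.inr (Sum.inl (e i))), by simp [algOut], by simp,
        fun x r => by simp [runBool, algInit]⟩
    · refine ⟨Sum.inr (Sum.inr (Sum.inr ⟨0, by omega⟩)), by simp [algOut], fun a ha h => ?_,
        fun x r => rfl⟩
      simp only [Sum.inr.injEq] at h
      subst h
      simp at ha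
  | @gate s A B h op f g hf hg ih =>
    obtain ⟨C, hC, hget⟩ := ih (by omega) hA
    obtain ⟨p, hpo, hpa, hp⟩ := hget f hf
    obtain ⟨q, hqo, hqa, hq⟩ := hget g hg
    refine ⟨C ++ [⟨op, p, q, Sum.inr (Sum.inr (Sum.inr ⟨s + 1, hs⟩))⟩], by simpa using hC, ?_⟩
    · rintro f' (rfl | hf')
      · refine ⟨Sum.inr (Sum.inr (Sum.inr ⟨s + 1, hs⟩)), by simp [algOut], ?_, fun x r => ?_⟩
        · intro a ha h
          simp only [Sum.inr.injEq] at h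
          subst h
          simp at ha
        · show _ = op (f (x, r)) (g (x, r))
          rw [runBool_append, ← hp, ← hq]
          simp [runBool, BoolGate.apply]
      · obtain ⟨j, hjo, hja, hj⟩ := hget f' hf'
        refine ⟨j, hjo, fun a ha => hja a (by omega), fun x r => ?_⟩
        rw [runBool_append, ← hj]
        have : j ≠ Sum.inr (Sum.inr (Sum.inr ⟨s + 1, hs⟩)) := hja _ (by simp)
        simp [runBool, BoolGate.apply, Function.update_of_ne this]

/-- Copying wires `p o` that are not output wires to the output wires. -/
theorem runBool_copy {T : Type} [DecidableEq T] (p : O → AlgWire I O T)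
    (hp : ∀ o o', p o ≠ algOut o') (l : List O) (s : AlgWire I O T → Bool) :
    (∀ j, (∀ o, j ≠ algOut o) →
      runBool (l.map fun o => ⟨fun a _ => a, p o, p o, algOut o⟩) s j = s j) ∧
    ∀ o ∈ l, runBool (l.map fun o => ⟨fun a _ => a, p o, p o, algOut o⟩) s (algOut o) = s (p o) := by
  induction l generalizing s with
  | nil => simp [runBool]
  | cons o l ih =>
    obtain ⟨ih1, ih2⟩ := ih (BoolGate.apply ⟨fun a _ => a, p o, p o, algOut o⟩ s)
    have hstep : ∀ j, (∀ o, j ≠ algOut o) →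
        BoolGate.apply ⟨fun a _ => a, p o, p o, algOut o⟩ s j = s j := fun j hj => by
      simp [BoolGate.apply, Function.update_of_ne (hj o)]
    refine ⟨fun j hj => (ih1 j hj).trans (hstep j hj), fun o' ho' => ?_⟩
    by_cases hl : o' ∈ l
    · exact (ih2 o' hl).trans (hstep _ (hp o'))
    · have : o' = o := by simpa [hl] using ho'
      subst this
      -- Later copies do not touch this output wire, as `o'` does not occur again.
      have hout : ∀ (l : List O) (s : AlgWire I O T → Bool), o' ∉ l →
          runBool (l.map fun o => ⟨fun a _ => a, p o, p o, algOut o⟩) s (algOut o') =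
            s (algOut o') := by
        intro l
        induction l with
        | nil => simp [runBool]
        | cons o l ih =>
          intro s hl
          simp only [List.mem_cons, not_or] at hl
          refine (ih _ hl.2).trans ?_
          have : (algOut o' : AlgWire I O T) ≠ algOut o := by simpa [algOut] using hl.1
          simp [BoolGate.apply, Function.update_of_ne this]
      refine (hout l _ hl).trans ?_
      simp [BoolGate.apply]

/-- A family of functions of the input and of uniform coins with a short straight-line program is
computed by a small randomized circuit. -/
theorem Cost.exists_classicalAlg {K : Type} [Fintype I] [Fintype O] [Fintype K]
    [DecidableEq K]
    (h : (I → Bool) → (K → Bool) → O → Bool) {s : ℕ}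
    (hs : Cost (basicFunctions I K) s (Set.range fun o ω => h ω.1 ω.2 o)) :
    ∃ A : ClassicalAlg I O,
      A.size ≤ Fintype.card I + 2 * Fintype.card O + Fintype.card K + 2 * s + 1 ∧
      ∀ x z, A.prob x z =
        (∑ c : K → Bool, if h x c = z then (1 : ℝ) else 0) / 2 ^ Fintype.card K := by
  obtain ⟨B, hB, hT⟩ := hs _ subset_rfl
  have e := Fintype.equivFin K
  obtain ⟨C, hC, hget⟩ := hB.exists_circuit (O := O) e (Nat.lt_succ_self s)
  choose p hpo _ hp using fun o => hget _ (hT ⟨o, rfl⟩)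
  have hcopy := runBool_copy p hpo (Finset.univ : Finset O).toList
  -- The `s + 1` work wires hold the constant zero and at most `s` gate values.
  let A : ClassicalAlg I O := ⟨Fintype.card K, s + 1,
    C ++ (Finset.univ : Finset O).toList.map fun o => ⟨fun a _ => a, p o, p o, algOut o⟩⟩
  have hev : ∀ x r, A.eval x (r ∘ e.symm) = h x r := fun x r => by
    funext o
    rw [ClassicalAlg.eval, runBool_append, (hcopy _).2 o (by simp), hp]
  refine ⟨A, ?_, fun x z => ?_⟩
  · simp only [ClassicalAlg.size, A, Fintype.card_sum, Fintype.card_fin, List.length_append,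
      List.length_map, Finset.length_toList, Finset.card_univ]
    omega
  · rw [ClassicalAlg.prob]
    congr 1
    refine (Fintype.sum_equiv (Equiv.arrowCongr e (Equiv.refl Bool)) _ _ fun r => ?_).symm
    rw [← hev]
    rfl

end Realize

/-! ## The Goldreich-Levin decoder -/

/-- The parity of the bits `v j` with `j ∈ J`. -/
noncomputable def xorSum {ι : Type*} (v : ι → Bool) (J : Finset ι) : Bool :=
  J.toList.foldr (fun j b => xor (v j) b) false

theorem bsign_injective : Function.Injective bsign := by
  intro a b
  cases a <;> cases b <;> norm_num [bsign]

theorem bsign_xorSum {ι : Type*} (v : ι → Bool) (J : Finset ι) :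
    bsign (xorSum v J) = ∏ j ∈ J, bsign (v j) := by
  rw [xorSum, ← Finset.prod_map_toList]
  induction J.toList with
  | nil => simp
  | cons j l ih => simp [bsign_xor, ih]

/-- Bitwise parity of the strings `S j` with `j ∈ J`. -/
noncomputable def combine {ι R : Type*} (S : ι → R → Bool) (J : Finset ι) : R → Bool :=
  fun i => xorSum (fun j => S j i) J

/-- Linearity of the parity: `t` guessed parities of the seeds determine those of all `2 ^ t`
combinations. -/
theorem parityChar_combine {ι R : Type*} [Fintype R] (S : ι → R → Bool) (J : Finset ι)
    (x : R → Bool) : parityChar (combine S J) x = ∏ j ∈ J, parityChar (S j) x := by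
  simp only [parityChar]
  rw [Finset.prod_comm]
  refine Finset.prod_congr rfl fun i _ => ?_
  cases x i
  · simp
  · simpa [combine] using bsign_xorSum (fun j => S j i) J

/-- Bitwise addition of a string, as a permutation. -/
def xorEquiv {R : Type*} (a : R → Bool) : Equiv.Perm (R → Bool) where
  toFun r := fun i => xor (r i) (a i)
  invFun r := fun i => xor (r i) (a i)
  left_inv r := by simp
  right_inv r := by simp

theorem xorEquiv_apply {R : Type*} (a r : R → Bool) (i : R) :
    xorEquiv a r i = xor (r i) (a i) := rfl

theorem xorEquiv_comm {R : Type*} (a r : R → Bool) : xorEquiv a r = xorEquiv r a := by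
  funext i
  simp [xorEquiv_apply, Bool.xor_comm]

section Decoder

variable {ι R : Type*} [Fintype ι] [Fintype R] [DecidableEq R]

/-- The vote of the subset `J` for the bit `i`. -/
noncomputable def vote (g : (R → Bool) → Bool) (S : ι → R → Bool) (β : ι → Bool) (i : R)
    (J : Finset ι) : Bool :=
  xor (xorSum β J) (g (xorEquiv (fun j => decide (j = i)) (combine S J)))

/-- The decoder: a majority vote for each bit. -/
noncomputable def decode (g : (R → Bool) → Bool) (S : ι → R → Bool) (β : ι → Bool) : R → Bool :=
  fun i => decide (2 ^ Fintype.card ι / 2 + 1 ≤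
    ((Finset.univ : Finset (Finset ι)).toList.map (vote g S β i)).countP fun b => b)

theorem sum_bsign_eq (l : List Bool) :
    (l.map bsign).sum = l.length - 2 * (l.countP fun b => b : ℕ) := by
  induction l with
  | nil => simp
  | cons b l ih =>
    cases b
    · simp [ih]; ring
    · simp [ih]; ring

/-- With correct guesses, the vote of `J` is `r_J·x ⊕ g(r_J ⊕ e_i)`, where `r_J` is the combination.
It equals `x i` exactly when `g` predicts the parity at `r_J ⊕ e_i`, so the hypothesis says that a
strict majority of the votes for each bit is right. -/
theorem decode_eq {g : (R → Bool) → Bool} {S : ι → R → Bool} {x : R → Bool}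
    (h : ∀ i, 0 < ∑ J : Finset ι, bsign (g (xorEquiv (fun j => decide (j = i)) (combine S J))) *
      parityChar (xorEquiv (fun j => decide (j = i)) (combine S J)) x) :
    decode g S (fun j => parityBit (S j) x) = x := by
  funext i
  have hi := h i
  have hv : ∀ J, bsign (vote g S (fun j => parityBit (S j) x) i J) =
      bsign (x i) * (bsign (g (xorEquiv (fun j => decide (j = i)) (combine S J))) *
        parityChar (xorEquiv (fun j => decide (j = i)) (combine S J)) x) := fun J => by
    have h1 : parityChar (xorEquiv (fun j => decide (j = i)) (combine S J)) x =
        parityChar (combine S J) x * bsign (x i) := by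
      rw [← parityChar_single i x, ← parityChar_xor]
      rfl
    rw [h1, vote, bsign_xor, bsign_xorSum, parityChar_combine]
    simp only [bsign_parityBit]
    linear_combination (-(bsign (g (xorEquiv (fun j => decide (j = i)) (combine S J))) *
      ∏ j ∈ J, parityChar (S j) x)) * bsign_mul_self (x i)
  have hs := sum_bsign_eq
    ((Finset.univ : Finset (Finset ι)).toList.map (vote g S (fun j => parityBit (S j) x) i))
  rw [List.map_map, List.length_map, Finset.length_toList, Finset.card_univ,
    Fintype.card_finset] at hs
  have hs' : (List.map (bsign ∘ vote g S (fun j => parityBit (S j) x) i)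
      (Finset.univ : Finset (Finset ι)).toList).sum = bsign (x i) * ∑ J : Finset ι,
        bsign (g (xorEquiv (fun j => decide (j = i)) (combine S J))) *
        parityChar (xorEquiv (fun j => decide (j = i)) (combine S J)) x := by
    rw [Finset.sum_map_toList, Finset.mul_sum]
    exact Finset.sum_congr rfl fun J _ => hv J
  rw [hs'] at hs
  unfold decode
  generalize ((Finset.univ : Finset (Finset ι)).toList.map
    (vote g S (fun j => parityBit (S j) x) i)).countP (fun b => b) = m at *
  generalize 2 ^ Fintype.card ι = M at *
  cases hx : x i
  · rw [hx, bsign_false, one_mul] at hs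
    rw [hs, sub_pos] at hi
    have : 2 * m < M := by exact_mod_cast hi
    simp only [decide_eq_false_iff_not]
    omega
  · rw [hx, bsign_true] at hs
    have h2 : (M : ℝ) < 2 * m := by linarith
    have : M < 2 * m := by exact_mod_cast h2
    simp only [decide_eq_true_eq]
    omega

end Decoder

/-! ### Pairwise uncorrelated seed combinations and the second moment bound -/

section Shift

variable {ι R : Type*} [DecidableEq ι]

/-- Bitwise addition of `v` to the string `S j`, as a permutation of the families `S`. -/
def shiftEquiv (j : ι) (v : R → Bool) : Equiv.Perm (ι → R → Bool) where
  toFun S := Function.update S j (xorEquiv v (S j))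
  invFun S := Function.update S j (xorEquiv v (S j))
  left_inv S := by
    funext i
    by_cases h : i = j
    · subst h; funext; simp [xorEquiv]
    · simp [h]
  right_inv S := by
    funext i
    by_cases h : i = j
    · subst h; funext; simp [xorEquiv]
    · simp [h]

theorem combine_shift_of_mem {j : ι} {J : Finset ι} (hj : j ∈ J) (v : R → Bool)
    (S : ι → R → Bool) : combine (shiftEquiv j v S) J = xorEquiv v (combine S J) := by
  funext i
  apply bsign_injective
  rw [xorEquiv_apply, bsign_xor, combine, combine, bsign_xorSum, bsign_xorSum,
    ← Finset.mul_prod_erase J _ hj, ← Finset.mul_prod_erase J _ hj]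
  rw [Finset.prod_congr rfl (g := fun j => bsign (S j i)) fun k hk => ?_]
  · simp only [shiftEquiv, Equiv.coe_fn_mk, Function.update_self, xorEquiv_apply, bsign_xor]
    ring
  · simp [shiftEquiv, Finset.ne_of_mem_erase hk]

theorem combine_shift_of_notMem {j : ι} {J : Finset ι} (hj : j ∉ J) (v : R → Bool)
    (S : ι → R → Bool) : combine (shiftEquiv j v S) J = combine S J := by
  funext i
  apply bsign_injective
  rw [combine, combine, bsign_xorSum, bsign_xorSum]
  refine Finset.prod_congr rfl fun k hk => ?_
  have : k ≠ j := fun h => hj (h ▸ hk)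
  simp [shiftEquiv, this]

variable [Fintype ι] [Fintype R] [DecidableEq R]

/-- Translating the seed `S j` by `v` translates the combination over `J` and fixes the one over
`J'`. Averaging over `v` replaces the first factor by the mean of `f`, which is zero. -/
theorem sum_combine_mul_combine_of_mem {f : (R → Bool) → ℝ} (hf : ∑ r, f r = 0) {J J' : Finset ι}
    {j : ι} (hj : j ∈ J) (hj' : j ∉ J') :
    ∑ S : ι → R → Bool, f (combine S J) * f (combine S J') = 0 := by
  have h1 : ∀ v : R → Bool, ∑ S : ι → R → Bool, f (combine S J) * f (combine S J') =
      ∑ S : ι → R → Bool, f (xorEquiv v (combine S J)) * f (combine S J') := fun v => by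
    rw [← Equiv.sum_comp (shiftEquiv j v)]
    exact Finset.sum_congr rfl fun S _ => by
      rw [combine_shift_of_mem hj, combine_shift_of_notMem hj']
  have h2 : ∑ _v : R → Bool, ∑ S : ι → R → Bool, f (combine S J) * f (combine S J') = 0 := by
    rw [Finset.sum_congr rfl fun v _ => h1 v, Finset.sum_comm]
    refine Finset.sum_eq_zero fun S _ => ?_
    rw [← Finset.sum_mul]
    simp only [fun v => xorEquiv_comm v (combine S J)]
    rw [Equiv.sum_comp, hf, zero_mul]
  rw [Finset.sum_const, nsmul_eq_mul] at h2
  exact (mul_eq_zero.1 h2).resolve_left (by simp)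

theorem sum_combine_mul_combine {f : (R → Bool) → ℝ} (hf : ∑ r, f r = 0) {J J' : Finset ι}
    (h : J ≠ J') : ∑ S : ι → R → Bool, f (combine S J) * f (combine S J') = 0 := by
  by_cases hJ : J ⊆ J'
  · have : ¬ J' ⊆ J := fun h' => h (hJ.antisymm h')
    obtain ⟨j, hj, hj'⟩ := Finset.not_subset.1 this
    rw [← sum_combine_mul_combine_of_mem hf hj hj']
    exact Finset.sum_congr rfl fun S _ => mul_comm _ _
  · obtain ⟨j, hj, hj'⟩ := Finset.not_subset.1 hJ
    exact sum_combine_mul_combine_of_mem hf hj hj'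

/-- The combinations `combine S J` are pairwise uncorrelated. -/
theorem sum_sq_sum_combine_le {f : (R → Bool) → ℝ} (hf : ∑ r, f r = 0) {B : ℝ}
    (hB : ∀ r, f r ^ 2 ≤ B) :
    ∑ S : ι → R → Bool, (∑ J : Finset ι, f (combine S J)) ^ 2 ≤
      2 ^ Fintype.card ι * Fintype.card (ι → R → Bool) * B := by
  have h1 : ∀ S : ι → R → Bool, (∑ J : Finset ι, f (combine S J)) ^ 2 =
      ∑ J : Finset ι, ∑ J' : Finset ι, f (combine S J) * f (combine S J') := fun S => by
    rw [sq, Finset.sum_mul_sum]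
  rw [Finset.sum_congr rfl fun S _ => h1 S, Finset.sum_comm]
  have h2 : ∀ J : Finset ι, ∑ S : ι → R → Bool, ∑ J' : Finset ι,
      f (combine S J) * f (combine S J') ≤ Fintype.card (ι → R → Bool) * B := fun J => by
    -- Only the diagonal survives. The empty set, whose combination is constantly zero and not
    -- uniform, needs no special treatment: its diagonal term obeys the same bound.
    rw [Finset.sum_comm, Finset.sum_eq_single J]
    · refine (Finset.sum_le_sum fun S _ => ?_).trans_eq
        ((Finset.sum_const B).trans (by rw [Finset.card_univ, nsmul_eq_mul]))
      rw [← sq]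
      exact hB _
    · exact fun J' _ hJ' => sum_combine_mul_combine hf hJ'.symm
    · simp
  refine (Finset.sum_le_sum fun J _ => h2 J).trans_eq ?_
  rw [Finset.sum_const, Finset.card_univ, Fintype.card_finset, nsmul_eq_mul]
  push_cast
  ring

/-- Chebyshev's inequality: for a bad seed the centred sum deviates from zero by at least `2 ^ t *
μ`, with `t` the number of seeds, while its mean square is at most `2 ^ t * 4`, since `|h - μ| ≤ 2`.
-/
theorem card_bad_mul_le (h : (R → Bool) → ℝ) (hh : ∀ r, |h r| ≤ 1) {μ : ℝ}
    (hμ : ∑ r, h r = 2 ^ Fintype.card R * μ) (hμ0 : 0 < μ) (a : R → Bool) :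
    ((Finset.univ.filter fun S : ι → R → Bool =>
      ∑ J : Finset ι, h (xorEquiv a (combine S J)) ≤ 0).card : ℝ) *
      (2 ^ Fintype.card ι * μ ^ 2) ≤ 4 * Fintype.card (ι → R → Bool) := by
  have hμ1 : μ ≤ 1 := by
    have h1 : ∑ r, h r ≤ ∑ _r : R → Bool, (1 : ℝ) :=
      Finset.sum_le_sum fun r _ => (abs_le.1 (hh r)).2
    rw [hμ] at h1
    simp only [Finset.sum_const, Finset.card_univ, Fintype.card_fun, Fintype.card_bool,
      nsmul_eq_mul, mul_one, Nat.cast_pow, Nat.cast_ofNat] at h1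
    have h2 : (0 : ℝ) < 2 ^ Fintype.card R := by positivity
    nlinarith
  have hf : ∑ r, (h (xorEquiv a r) - μ) = 0 := by
    rw [Finset.sum_sub_distrib, Equiv.sum_comp, hμ]
    simp
  have hvar := sum_sq_sum_combine_le (ι := ι) hf (B := 4) fun r => by
    have := abs_le.1 (hh (xorEquiv a r))
    nlinarith
  have hM : (0 : ℝ) < 2 ^ Fintype.card ι := by positivity
  have h1 : ((Finset.univ.filter fun S : ι → R → Bool =>
      ∑ J : Finset ι, h (xorEquiv a (combine S J)) ≤ 0).card : ℝ) *
      (2 ^ Fintype.card ι * μ) ^ 2 ≤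
      ∑ S : ι → R → Bool, (∑ J : Finset ι, (h (xorEquiv a (combine S J)) - μ)) ^ 2 := by
    rw [← nsmul_eq_mul, ← Finset.sum_const]
    refine (Finset.sum_le_sum fun S hS => ?_).trans
      (Finset.sum_le_sum_of_subset_of_nonneg (Finset.filter_subset _ _) fun _ _ _ => sq_nonneg _)
    rw [Finset.sum_sub_distrib, Finset.sum_const, Finset.card_univ, Fintype.card_finset,
      nsmul_eq_mul]
    push_cast
    have := (Finset.mem_filter.1 hS).2
    nlinarith [mul_pos hM hμ0]
  have h2 := h1.trans hvar
  refine le_of_mul_le_mul_left ?_ hM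
  calc _ = _ := by ring
    _ ≤ _ := h2
    _ = _ := by ring

/-- If `g` agrees with the parity `r ↦ r·x` with bias `μ`, then the decoder succeeds with
probability at least `(μ - δ/2)/2` over the seeds, for one choice of the guesses. -/
theorem le_sum_decode (g : (R → Bool) → Bool) (x : R → Bool) {μ δ : ℝ} (hδ : 0 < δ)
    (hμ : ∑ r, bsign (g r) * parityChar r x = 2 ^ Fintype.card R * μ)
    (hM : 32 * ((Fintype.card R : ℝ) + 1) ≤ 2 ^ Fintype.card ι * δ ^ 2) :
    (μ - δ / 2) / 2 * Fintype.card (ι → R → Bool) ≤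
      ∑ S : ι → R → Bool, ∑ β : ι → Bool, if decode g S β = x then (1 : ℝ) else 0 := by
  -- The lower bound is linear in `μ` and trivial for small `μ`, so that it can be averaged over
  -- keys and coins without first isolating those with a large bias.
  by_cases hμδ : μ ≤ δ / 2
  · refine (mul_nonpos_of_nonpos_of_nonneg (by linarith) (Nat.cast_nonneg _)).trans ?_
    exact Finset.sum_nonneg fun S _ => Finset.sum_nonneg fun β _ => by split_ifs <;> norm_num
  push Not at hμδ
  have hh : ∀ r, |bsign (g r) * parityChar r x| ≤ 1 := fun r => by
    rw [abs_mul, abs_bsign, abs_parityChar, one_mul]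
  have hμ1 : μ ≤ 1 := by
    have h1 : ∑ r, bsign (g r) * parityChar r x ≤ ∑ _r : R → Bool, (1 : ℝ) :=
      Finset.sum_le_sum fun r _ => (abs_le.1 (hh r)).2
    rw [hμ] at h1
    simp only [Finset.sum_const, Finset.card_univ, Fintype.card_fun, Fintype.card_bool,
      nsmul_eq_mul, mul_one, Nat.cast_pow, Nat.cast_ofNat] at h1
    have h2 : (0 : ℝ) < 2 ^ Fintype.card R := by positivity
    nlinarith
  let bad : R → Finset (ι → R → Bool) := fun i => Finset.univ.filter fun S =>
    ∑ J : Finset ι, bsign (g (xorEquiv (fun j => decide (j = i)) (combine S J))) *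
      parityChar (xorEquiv (fun j => decide (j = i)) (combine S J)) x ≤ 0
  -- As `μ > δ/2`, the constant `32` makes each bit fail for a fraction at most `1/(2(|R| + 1))` of
  -- the seeds; the union bound then leaves at least half of them good.
  have hbad : ∀ i, ((bad i).card : ℝ) * (8 * ((Fintype.card R : ℝ) + 1)) ≤
      4 * Fintype.card (ι → R → Bool) := fun i => by
    refine le_trans ?_ (card_bad_mul_le _ hh hμ (by linarith) fun j => decide (j = i))
    refine mul_le_mul_of_nonneg_left ?_ (Nat.cast_nonneg _)
    have h1 : (2 : ℝ) ^ Fintype.card ι * (δ / 2) ^ 2 ≤ 2 ^ Fintype.card ι * μ ^ 2 := by gcongr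
    nlinarith
  have hU : ((Finset.univ.biUnion bad).card : ℝ) ≤ Fintype.card (ι → R → Bool) / 2 := by
    have h1 : ((Finset.univ.biUnion bad).card : ℝ) ≤ ∑ i, ((bad i).card : ℝ) := by
      exact_mod_cast Finset.card_biUnion_le
    have h2 : (∑ i, ((bad i).card : ℝ)) * (8 * ((Fintype.card R : ℝ) + 1)) ≤
        Fintype.card R * (4 * Fintype.card (ι → R → Bool)) := by
      rw [Finset.sum_mul]
      refine (Finset.sum_le_sum fun i _ => hbad i).trans_eq ?_
      rw [Finset.sum_const, Finset.card_univ, nsmul_eq_mul]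
    have h3 : (0 : ℝ) ≤ Fintype.card R := Nat.cast_nonneg _
    have h4 : (0 : ℝ) ≤ Fintype.card (ι → R → Bool) := Nat.cast_nonneg _
    refine h1.trans (le_of_mul_le_mul_right (h2.trans ?_)
      (show (0 : ℝ) < 8 * ((Fintype.card R : ℝ) + 1) by positivity))
    nlinarith
  have hgood : ∀ S ∉ Finset.univ.biUnion bad,
      (1 : ℝ) ≤ ∑ β : ι → Bool, if decode g S β = x then (1 : ℝ) else 0 := fun S hS => by
    -- For a good seed the true parities are one successful choice of guesses.
    have h1 : decode g S (fun j => parityBit (S j) x) = x := decode_eq fun i => by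
      by_contra hi
      exact hS (Finset.mem_biUnion.2 ⟨i, Finset.mem_univ _,
        Finset.mem_filter.2 ⟨Finset.mem_univ _, not_lt.1 hi⟩⟩)
    refine le_trans ?_ (Finset.single_le_sum (fun β _ => ?_)
      (Finset.mem_univ fun j => parityBit (S j) x))
    · rw [if_pos h1]
    · split_ifs <;> norm_num
  have hcount : (Fintype.card (ι → R → Bool) : ℝ) - (Finset.univ.biUnion bad).card ≤
      ∑ S : ι → R → Bool, ∑ β : ι → Bool, if decode g S β = x then (1 : ℝ) else 0 := by
    have h1 : (((Finset.univ.biUnion bad)ᶜ).card : ℝ) =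
        (Fintype.card (ι → R → Bool) : ℝ) - (Finset.univ.biUnion bad).card := by
      rw [Finset.card_compl, Nat.cast_sub (Finset.card_le_univ _)]
    rw [← h1, ← mul_one ((_ : ℕ) : ℝ), ← nsmul_eq_mul, ← Finset.sum_const]
    refine (Finset.sum_le_sum fun S hS => hgood S (Finset.mem_compl.1 hS)).trans
      (Finset.sum_le_sum_of_subset_of_nonneg (Finset.subset_univ _) fun S _ _ =>
        Finset.sum_nonneg fun β _ => by split_ifs <;> norm_num)
  have h4 : (0 : ℝ) ≤ Fintype.card (ι → R → Bool) := Nat.cast_nonneg _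
  -- At least half of the seeds succeed, and `(μ - δ/2)/2 ≤ 1/2`.
  nlinarith

end Shift

/-! ## Classical soundness -/

namespace ClassicalProver

variable {a v n : ℕ} (P : ClassicalProver a v n)

/-- The sum of the prover's answers to the two challenges, with fixed coins. -/
def guess (k : Bits a) (c : Bits P.coins) (r : Fin n ⊕ Fin n → Bool) : Bool :=
  xor (P.state₃ k (r ∘ Sum.inl) (r ∘ Sum.inr) false c .ans)
    (P.state₃ k (r ∘ Sum.inl) (r ∘ Sum.inr) true c .ans)

/-- The first message, with fixed coins. -/
def firstMessage (k : Bits a) (c : Bits P.coins) : Bits v := fun i => P.state₁ k c (.img i)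

/-- With fixed coins the three messages are determined, so the sums over messages collapse. -/
theorem sum_resp (k : Bits a) (r₀ r₁ : Bits n) (m : Bool)
    (p : Bits v → Bits n → Bool → Prop) [∀ y d b, Decidable (p y d b)] :
    ∑ y, ∑ d, ∑ b, (if p y d b then P.resp k r₀ r₁ m y d b else 0) =
      (∑ c, if p (P.firstMessage k c) (fun i => P.state₂ k r₀ r₁ c (.d i))
        (P.state₃ k r₀ r₁ m c .ans) then (1 : ℝ) else 0) / 2 ^ P.coins := by
  have h1 : ∀ y d b, (if p y d b then P.resp k r₀ r₁ m y d b else 0) =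
      ∑ c, (if P.firstMessage k c = y then (if (fun i => P.state₂ k r₀ r₁ c (.d i)) = d then
        (if P.state₃ k r₀ r₁ m c .ans = b then (if p y d b then (1 : ℝ) else 0) else 0) else 0)
        else 0) / 2 ^ P.coins := fun y d b => by
    rw [resp, ← Finset.sum_div]
    split_ifs with h
    · congr 1
      refine Finset.sum_congr rfl fun c _ => ?_
      simp only [ite_and]
      rfl
    · simp
  simp only [h1]
  rw [Finset.sum_div]
  calc _ = ∑ c, ∑ y, ∑ d, ∑ b, (if P.firstMessage k c = y then
        (if (fun i => P.state₂ k r₀ r₁ c (.d i)) = d then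
        (if P.state₃ k r₀ r₁ m c .ans = b then (if p y d b then (1 : ℝ) else 0) else 0) else 0)
        else 0) / 2 ^ P.coins := by
        symm
        rw [Finset.sum_comm]
        refine Finset.sum_congr rfl fun y _ => ?_
        rw [Finset.sum_comm]
        refine Finset.sum_congr rfl fun d _ => ?_
        rw [Finset.sum_comm]
    _ = _ := by
        refine Finset.sum_congr rfl fun c _ => ?_
        simp only [← Finset.sum_div, Finset.sum_ite_irrel, Finset.sum_const_zero,
          Finset.sum_ite_eq, Finset.mem_univ, if_true]

end ClassicalProver

/-- If the two parities differ, exactly one answer is correct and the right side is `1`; if they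
agree, the right side is `2`. -/
theorem sum_correct_le (b c : Bool → Bool) :
    ∑ m, (if b m = c m then (1 : ℝ) else 0) ≤
      3 / 2 + bsign (xor (b false) (b true)) * bsign (xor (c false) (c true)) / 2 := by
  rw [Fintype.sum_bool]
  cases b false <;> cases b true <;> cases c false <;> cases c true <;> norm_num

namespace FunFamily

variable (F : FunFamily) (l : ℕ)

/-- The two preimages found by `Inv`, as one string. -/
def invPair (t : Bits (F.tdLen l)) (y : Bits (F.imgLen l)) :
    Fin (F.inLen l) ⊕ Fin (F.inLen l) → Bool :=
  Sum.elim (F.Inv l t y).1 (F.Inv l t y).2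

open Classical in
/-- The advantage of `g k c` in predicting the parity of the coordinates of the preimages of
`y k c` that are selected by a random string. -/
noncomputable def advantage {c : ℕ} (y : Bits (F.keyLen l) → Bits c → Bits (F.imgLen l))
    (g : Bits (F.keyLen l) → Bits c → (Fin (F.inLen l) ⊕ Fin (F.inLen l) → Bool) → Bool) : ℝ :=
  F.genAvg l fun k t => (∑ u, if ∃ x ∈ F.dom l k, F.f l k x = y k u then
    (∑ r, bsign (g k u r) * parityChar r (F.invPair l t (y k u))) /
      2 ^ Fintype.card (Fin (F.inLen l) ⊕ Fin (F.inLen l)) else 0) / 2 ^ c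

/-- Rewinding: `y` and `d` do not depend on `m`, so for fixed coins both challenges are answered in
the same situation and `sum_correct_le` applies. An invalid `y` is rejected and contributes no bias.
-/
theorem acceptProb_classical_le
    (P : ClassicalProver (F.keyLen l) (F.imgLen l) (F.inLen l)) :
    F.acceptProb l P.resp ≤ 3 / 4 + 1 / 4 * F.advantage l P.firstMessage P.guess := by
  classical
  rw [← F.genAvg_const l (3 / 4), advantage, ← F.genAvg_const_mul, ← F.genAvg_add]
  refine F.genAvg_mono fun k t _ => ?_
  set N : ℝ := 2 ^ F.inLen l with hN
  have hNpos : 0 < N := by positivity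
  have hcard : (2 : ℝ) ^ Fintype.card (Fin (F.inLen l) ⊕ Fin (F.inLen l)) = N * N := by
    rw [Fintype.card_sum, Fintype.card_fin, pow_add]
  have hKpos : (0 : ℝ) < 2 ^ P.coins := by positivity
  have hcoin : ∀ c, ∑ r₀ : Bits (F.inLen l), ∑ r₁ : Bits (F.inLen l), ∑ m : Bool,
      (if F.Accepts l k t (P.firstMessage k c) r₀ r₁ (fun i => P.state₂ k r₀ r₁ c (.d i)) m
        (P.state₃ k r₀ r₁ m c .ans) then (1 : ℝ) else 0) ≤
      N * N * 2 * (3 / 4 + 1 / 4 * (if ∃ x ∈ F.dom l k, F.f l k x = P.firstMessage k c then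
        (∑ r, bsign (P.guess k c r) * parityChar r (F.invPair l t (P.firstMessage k c))) /
          2 ^ Fintype.card (Fin (F.inLen l) ⊕ Fin (F.inLen l)) else 0)) := fun c => by
    by_cases hg : ∃ x ∈ F.dom l k, F.f l k x = P.firstMessage k c
    · rw [if_pos hg, hcard]
      have h1 : ∀ r₀ r₁ : Bits (F.inLen l), ∑ m : Bool,
          (if F.Accepts l k t (P.firstMessage k c) r₀ r₁ (fun i => P.state₂ k r₀ r₁ c (.d i)) m
            (P.state₃ k r₀ r₁ m c .ans) then (1 : ℝ) else 0) ≤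
          3 / 2 + bsign (P.guess k c (Sum.elim r₀ r₁)) *
            parityChar (Sum.elim r₀ r₁) (F.invPair l t (P.firstMessage k c)) / 2 := by
        intro r₀ r₁
        obtain ⟨b, hb, hb'⟩ := exists_correct_answer (F.Inv l t (P.firstMessage k c)).1
          (F.Inv l t (P.firstMessage k c)).2 r₀ r₁ (fun i => P.state₂ k r₀ r₁ c (.d i))
        rw [invPair, ← hb']
        simp only [Accepts, hb, hg, true_and]
        exact sum_correct_le (fun m => P.state₃ k r₀ r₁ m c .ans) b
      refine (Finset.sum_le_sum fun r₀ _ => Finset.sum_le_sum fun r₁ _ => h1 r₀ r₁).trans_eq ?_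
      rw [← (Equiv.sumArrowEquivProdArrow (Fin (F.inLen l)) (Fin (F.inLen l)) Bool).symm.sum_comp,
        Fintype.sum_prod_type]
      simp only [Finset.sum_add_distrib, ← Finset.sum_div, Finset.sum_const, Finset.card_univ,
        Fintype.card_fun, Fintype.card_bool, Fintype.card_fin, nsmul_eq_mul, Nat.cast_pow,
        Nat.cast_ofNat, ← hN]
      have : ∀ r₀ r₁, (Equiv.sumArrowEquivProdArrow (Fin (F.inLen l)) (Fin (F.inLen l)) Bool).symm
          (r₀, r₁) = Sum.elim r₀ r₁ := fun _ _ => rfl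
      simp only [this]
      field_simp
      ring
    · rw [if_neg hg]
      simp only [Accepts, hg, false_and, if_false, Finset.sum_const_zero]
      positivity
  have hsum : ∑ r₀ : Bits (F.inLen l), ∑ r₁ : Bits (F.inLen l), ∑ m : Bool,
      ∑ y : Bits (F.imgLen l), ∑ d : Bits (F.inLen l), ∑ b : Bool,
        (if F.Accepts l k t y r₀ r₁ d m b then P.resp k r₀ r₁ m y d b else 0) =
      (∑ c, ∑ r₀ : Bits (F.inLen l), ∑ r₁ : Bits (F.inLen l), ∑ m : Bool,
      (if F.Accepts l k t (P.firstMessage k c) r₀ r₁ (fun i => P.state₂ k r₀ r₁ c (.d i)) m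
        (P.state₃ k r₀ r₁ m c .ans) then (1 : ℝ) else 0)) / 2 ^ P.coins := by
    simp only [P.sum_resp, ← Finset.sum_div]
    congr 1
    symm
    rw [Finset.sum_comm]
    refine Finset.sum_congr rfl fun r₀ _ => ?_
    rw [Finset.sum_comm]
    refine Finset.sum_congr rfl fun r₁ _ => ?_
    rw [Finset.sum_comm]
  rw [hsum, div_div, div_le_iff₀ (by positivity)]
  refine (Finset.sum_le_sum fun c _ => hcoin c).trans_eq ?_
  rw [← Finset.mul_sum, Finset.sum_add_distrib, ← Finset.mul_sum, Finset.sum_const,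
    Finset.card_univ, Fintype.card_fun, Fintype.card_bool, Fintype.card_fin, nsmul_eq_mul]
  push_cast
  field_simp

end FunFamily

/-! ## The cost of the decoder -/

namespace Cost

variable {X : Type*} {A : Set (X → Bool)}

theorem of_mem {f : X → Bool} (h : f ∈ A) (s : ℕ) : Cost A s {f} :=
  of_subset (Set.singleton_subset_iff.2 h)

theorem gate_family {ι : Type*} [Fintype ι] (f : ι → X → Bool)
    (h : ∀ i, f i ∈ A ∨ ∃ (op : Bool → Bool → Bool) (p q : X → Bool), p ∈ A ∧ q ∈ A ∧
      f i = fun x => op (p x) (q x)) : Cost A (Fintype.card ι) (Set.range f) :=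
  (family (s := 1) f fun i => by
    rcases h i with h | ⟨op, p, q, hp, hq, h⟩
    · exact of_mem h 1
    · rw [h]; exact gate op hp hq).mono_nat (by simp)

theorem xorSum {ι : Type*} [Fintype ι] (v : ι → X → Bool) (hv : ∀ i, v i ∈ A)
    (hA : (fun _ => false) ∈ A) (J : Finset ι) :
    Cost A (Fintype.card ι) {fun x => _root_.xorSum (fun i => v i x) J} :=
  (xorFold v hv hA J.toList).mono_nat (by simpa using Finset.card_le_univ J)

end Cost

namespace ClassicalProver

variable {a v n : ℕ} (P : ClassicalProver a v n)

/-- The state after the first round is assumed available: it does not depend on `r`, and all queries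
of the decoder share it. -/
theorem cost_answer {X : Type*} {A : Set (X → Bool)}
    {κ : X → Bits a} {c : X → Bits P.coins} {r : X → Fin n ⊕ Fin n → Bool}
    (hstate : ∀ w, (fun x => P.state₁ (κ x) (c x) w) ∈ A) (hr : ∀ i, (fun x => r x i) ∈ A)
    (hA : (fun _ => false) ∈ A) (m : Bool) :
    Cost A (3 * P.size)
      {fun x => P.state₃ (κ x) (r x ∘ Sum.inl) (r x ∘ Sum.inr) m (c x) .ans} := by
  let W := ProverWire a v n (Fin P.coins ⊕ Fin P.work)
  have h1 : Cost A (Fintype.card W) (Set.range fun (w : W) x =>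
      ProverWire.loadR (r x ∘ Sum.inl) (r x ∘ Sum.inr) (P.state₁ (κ x) (c x)) w) := by
    refine Cost.gate_family _ fun w => ?_
    cases w with
    | r₀ i => exact Or.inr ⟨xor, _, _, hstate (.r₀ i), hr (Sum.inl i), rfl⟩
    | r₁ i => exact Or.inr ⟨xor, _, _, hstate (.r₁ i), hr (Sum.inr i), rfl⟩
    | key i => exact Or.inl (hstate (.key i))
    | img i => exact Or.inl (hstate (.img i))
    | d i => exact Or.inl (hstate (.d i))
    | chal => exact Or.inl (hstate .chal)
    | ans => exact Or.inl (hstate .ans)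
    | work i => exact Or.inl (hstate (.work i))
  have h2 : Cost A (Fintype.card W + P.round₂.length) (Set.range fun (w : W) x =>
      P.state₂ (κ x) (r x ∘ Sum.inl) (r x ∘ Sum.inr) (c x) w) :=
    h1.trans (Cost.runBool P.round₂ _ fun w => Or.inr ⟨w, rfl⟩)
  have h3 : Cost A (Fintype.card W + P.round₂.length + Fintype.card W)
      (Set.range fun (w : W) x => ProverWire.loadM m
        (P.state₂ (κ x) (r x ∘ Sum.inl) (r x ∘ Sum.inr) (c x)) w) := by
    refine h2.trans (Cost.gate_family _ fun w => ?_)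
    cases w with
    | chal => exact Or.inr ⟨fun b _ => xor b m, _, _, Or.inr ⟨.chal, rfl⟩, Or.inl hA, rfl⟩
    | r₀ i => exact Or.inl (Or.inr ⟨.r₀ i, rfl⟩)
    | r₁ i => exact Or.inl (Or.inr ⟨.r₁ i, rfl⟩)
    | key i => exact Or.inl (Or.inr ⟨.key i, rfl⟩)
    | img i => exact Or.inl (Or.inr ⟨.img i, rfl⟩)
    | d i => exact Or.inl (Or.inr ⟨.d i, rfl⟩)
    | ans => exact Or.inl (Or.inr ⟨.ans, rfl⟩)
    | work i => exact Or.inl (Or.inr ⟨.work i, rfl⟩)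
  have h4 := h3.trans (Cost.runBool P.round₃ _ fun w => Or.inr ⟨w, rfl⟩)
  refine h4.mono subset_rfl ?_ (Set.singleton_subset_iff.2 ⟨.ans, rfl⟩)
  have hW : Fintype.card W = Fintype.card (ProverWire a v n (Fin P.coins ⊕ Fin P.work)) := rfl
  rw [hW]
  simp only [size]
  omega

theorem cost_state₁ {X : Type*} {A : Set (X → Bool)} {κ : X → Bits a} {c : X → Bits P.coins}
    (hκ : ∀ i, (fun x => κ x i) ∈ A) (hc : ∀ i, (fun x => c x i) ∈ A)
    (hA : (fun _ => false) ∈ A) :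
    Cost A P.size (Set.range fun w x => P.state₁ (κ x) (c x) w) := by
  refine (Cost.runBool P.round₁ (fun x => ProverWire.init (κ x) (Sum.elim (c x) fun _ => false))
    fun w => ?_).mono_nat (by simp only [size]; omega)
  rcases w with i | i | i | i | i | _ | _ | (j | j)
  · exact hκ i
  any_goals exact hA
  exact hc j

/-- The messages occupy wires of the prover, so a polynomial-size prover also bounds their lengths,
in particular `n`. -/
theorem le_size : a + 2 * n + P.coins ≤ P.size := by
  have h : Fintype.card (Fin a ⊕ (Fin n ⊕ Fin n) ⊕ Fin P.coins) ≤
      Fintype.card (ProverWire a v n (Fin P.coins ⊕ Fin P.work)) := by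
    refine Fintype.card_le_of_injective (Sum.elim ProverWire.key (Sum.elim
      (Sum.elim ProverWire.r₀ ProverWire.r₁) fun c => ProverWire.work (Sum.inl c))) ?_
    rintro (i | (i | i) | i) (j | (j | j) | j) h <;> simp_all
  simp only [Fintype.card_sum, Fintype.card_fin] at h
  simp only [size]
  omega

/-- The coins of the decoder: the prover's coins, the seeds and the guesses. -/
abbrev DecoderCoins (t : ℕ) : Type :=
  Fin P.coins ⊕ (Fin t × (Fin n ⊕ Fin n) ⊕ Fin t)

/-- The decoder applied to the prover's guess. -/
noncomputable def decoder (t : ℕ) (k : Bits a) (u : P.DecoderCoins t → Bool) :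
    Fin n ⊕ Fin n → Bool :=
  decode (P.guess k (u ∘ Sum.inl)) (fun j i => u (Sum.inr (Sum.inl (j, i))))
    (fun j => u (Sum.inr (Sum.inr j)))

theorem cost_vote {X : Type*} {A : Set (X → Bool)} {t : ℕ} {κ : X → Bits a}
    {c : X → Bits P.coins} {S : X → Fin t → Fin n ⊕ Fin n → Bool} {β : X → Fin t → Bool}
    (hstate : ∀ w, (fun x => P.state₁ (κ x) (c x) w) ∈ A)
    (hS : ∀ j i, (fun x => S x j i) ∈ A) (hβ : ∀ j, (fun x => β x j) ∈ A)
    (hA : (fun _ => false) ∈ A) (i : Fin n ⊕ Fin n) (J : Finset (Fin t)) :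
    Cost A ((P.size + 2) * (t + 7)) {fun x => vote (P.guess (κ x) (c x)) (S x) (β x) i J} := by
  have hz : n + n ≤ P.size := by have := P.le_size; omega
  have h1 : Cost A (P.size * (t + 1))
      (Set.range fun i' x => xorEquiv (fun j => decide (j = i)) (combine (S x) J) i') := by
    refine (Cost.family (s := t + 1) _ fun i' => ?_).mono_nat
      (Nat.mul_le_mul_right _ (by simpa using hz))
    refine ((Cost.xorSum (fun (j : Fin t) x => S x j i') (fun j => hS j i') hA J).mono_nat
      (s' := t) (by simp)).trans ?_
    exact Cost.gate (fun b _ => xor b (decide (i' = i))) (Or.inr rfl) (Or.inl hA)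
  have h2 := fun m => P.cost_answer (κ := κ) (c := c)
    (A := A ∪ (Set.range fun i' x => xorEquiv (fun j => decide (j = i)) (combine (S x) J) i'))
    (r := fun x => xorEquiv (fun j => decide (j = i)) (combine (S x) J))
    (fun w => Or.inl (hstate w)) (fun i => Or.inr ⟨i, rfl⟩) (Or.inl hA) m
  have h3 := h1.trans (((h2 false).union (h2 true)).trans
    (Cost.gate xor (Or.inr (Or.inl rfl)) (Or.inr (Or.inr rfl))))
  have h4 := Cost.xorSum (fun (j : Fin t) x => β x j) hβ hA J
  have h5 := (h4.union h3).trans (Cost.gate xor (Or.inr (Or.inl rfl)) (Or.inr (Or.inr rfl)))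
  refine h5.mono_nat ?_
  rw [Fintype.card_fin]
  nlinarith

theorem cost_decode {X : Type*} {A : Set (X → Bool)} {t : ℕ} {κ : X → Bits a}
    {c : X → Bits P.coins} {S : X → Fin t → Fin n ⊕ Fin n → Bool} {β : X → Fin t → Bool}
    (hκ : ∀ i, (fun x => κ x i) ∈ A) (hc : ∀ i, (fun x => c x i) ∈ A)
    (hS : ∀ j i, (fun x => S x j i) ∈ A) (hβ : ∀ j, (fun x => β x j) ∈ A)
    (hA : (fun _ => false) ∈ A) :
    Cost A (P.size + (P.size * 2 ^ t * ((P.size + 2) * (t + 7)) +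
        P.size * ((2 ^ t + 1) + 2 ^ t * ((2 ^ t + 1) * 2))))
      (Set.range fun o x => decode (P.guess (κ x) (c x)) (S x) (β x) o) := by
  have hz : n + n ≤ P.size := by have := P.le_size; omega
  refine (P.cost_state₁ hκ hc hA).trans ?_
  -- All votes, one for each bit and each subset of seeds, are computed before the thresholds are
  -- taken.
  refine Cost.trans (T := Set.range fun (p : (Fin n ⊕ Fin n) × Finset (Fin t)) x =>
    vote (P.guess (κ x) (c x)) (S x) (β x) p.1 p.2) ?_ ?_
  · refine (Cost.family (s := (P.size + 2) * (t + 7)) _ fun p => ?_).mono_nat ?_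
    · exact P.cost_vote (fun w => Or.inr ⟨w, rfl⟩) (fun j i => Or.inl (hS j i))
        (fun j => Or.inl (hβ j)) (Or.inl hA) p.1 p.2
    rw [Fintype.card_prod, Fintype.card_sum, Fintype.card_fin, Fintype.card_finset,
      Fintype.card_fin]
    exact Nat.mul_le_mul_right _ (Nat.mul_le_mul_right _ hz)
  · refine (Cost.family (s := (2 ^ t + 1) + 2 ^ t * ((2 ^ t + 1) * 2)) _ fun i => ?_).mono_nat
      (Nat.mul_le_mul_right _ (by simpa using hz))
    refine (Cost.threshold (2 ^ t) ((Finset.univ : Finset (Finset (Fin t))).toList.map fun J x =>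
      vote (P.guess (κ x) (c x)) (S x) (β x) i J) (fun v hv => ?_)
      (Or.inl (Or.inl hA))).mono subset_rfl (by simp) (Set.singleton_subset_iff.2
      ⟨⟨2 ^ t / 2 + 1, ?_⟩, funext fun x => ?_⟩)
    · obtain ⟨J, -, rfl⟩ := List.mem_map.1 hv
      exact Or.inr ⟨(i, J), rfl⟩
    · have : 0 < 2 ^ t := by positivity
      omega
    · simp only [decode, Fintype.card_fin, List.countP_map]
      rfl

theorem cost_decoder (t : ℕ) :
    Cost (basicFunctions (Fin a) (P.DecoderCoins t))
      (P.size + (P.size * 2 ^ t * ((P.size + 2) * (t + 7)) +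
        P.size * ((2 ^ t + 1) + 2 ^ t * ((2 ^ t + 1) * 2))))
      (Set.range fun o ω => P.decoder t ω.1 ω.2 o) :=
  P.cost_decode (fun i => Or.inr ⟨Sum.inl i, rfl⟩) (fun i => Or.inr ⟨Sum.inr (Sum.inl i), rfl⟩)
    (fun j i => Or.inr ⟨Sum.inr (Sum.inr (Sum.inl (j, i))), rfl⟩)
    (fun j => Or.inr ⟨Sum.inr (Sum.inr (Sum.inr j)), rfl⟩) (Set.mem_insert _ _)

end ClassicalProver

/-! ### Claw probabilities for a fixed key -/

namespace FunFamily

open Classical in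
/-- The probability of a claw, conditioned on the key. -/
noncomputable def clawProbAt (F : FunFamily) (l : ℕ) (k : Bits (F.keyLen l))
    (out : (Fin (F.inLen l) ⊕ Fin (F.inLen l) → Bool) → ℝ) : ℝ :=
  ∑ x₀ : Bits (F.inLen l), ∑ x₁ : Bits (F.inLen l),
    if F.IsClaw l k x₀ x₁ then out (Sum.elim x₀ x₁) else 0

theorem le_clawProbAt (F : FunFamily) {l : ℕ} {k : Bits (F.keyLen l)}
    {out : (Fin (F.inLen l) ⊕ Fin (F.inLen l) → Bool) → ℝ} (hout : ∀ z, 0 ≤ out z)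
    {x₀ x₁ : Bits (F.inLen l)} (h : F.IsClaw l k x₀ x₁) :
    out (Sum.elim x₀ x₁) ≤ F.clawProbAt l k out := by
  classical
  have h0 : ∀ x₀ x₁, 0 ≤ if F.IsClaw l k x₀ x₁ then out (Sum.elim x₀ x₁) else 0 :=
    fun x₀ x₁ => by split_ifs <;> simp [hout]
  refine le_trans ?_ (Finset.single_le_sum
    (f := fun x₀ => ∑ x₁, if F.IsClaw l k x₀ x₁ then out (Sum.elim x₀ x₁) else 0)
    (fun x₀ _ => Finset.sum_nonneg fun x₁ _ => h0 x₀ x₁) (Finset.mem_univ x₀))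
  refine le_trans ?_ (Finset.single_le_sum (fun x₁ _ => h0 x₀ x₁) (Finset.mem_univ x₁))
  rw [if_pos h]

theorem clawProbAt_nonneg (F : FunFamily) {l : ℕ} {k : Bits (F.keyLen l)}
    {out : (Fin (F.inLen l) ⊕ Fin (F.inLen l) → Bool) → ℝ} (hout : ∀ z, 0 ≤ out z) :
    0 ≤ F.clawProbAt l k out :=
  Finset.sum_nonneg fun _ _ => Finset.sum_nonneg fun _ _ => by split_ifs <;> simp [hout]

theorem clawProbAt_sum (F : FunFamily) {l : ℕ} {k : Bits (F.keyLen l)} {ι : Type*} [Fintype ι]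
    (out : ι → (Fin (F.inLen l) ⊕ Fin (F.inLen l) → Bool) → ℝ) :
    F.clawProbAt l k (fun z => ∑ i, out i z) = ∑ i, F.clawProbAt l k (out i) := by
  classical
  simp only [clawProbAt]
  symm
  rw [Finset.sum_comm]
  refine Finset.sum_congr rfl fun x₀ _ => ?_
  rw [Finset.sum_comm]
  refine Finset.sum_congr rfl fun x₁ _ => ?_
  split_ifs <;> simp

theorem clawProb_eq (F : FunFamily) (l : ℕ)
    (out : Bits (F.keyLen l) → (Fin (F.inLen l) ⊕ Fin (F.inLen l) → Bool) → ℝ) :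
    F.clawProb l out = F.genAvg l fun k _ => F.clawProbAt l k (out k) := rfl

end FunFamily

/-- The coins of the decoder, separated into prover's coins, seeds and guesses. -/
def decoderCoinsEquiv (K ι R : Type) :
    (K ⊕ (ι × R ⊕ ι) → Bool) ≃ (K → Bool) × (ι → R → Bool) × (ι → Bool) :=
  (Equiv.sumArrowEquivProdArrow _ _ _).trans ((Equiv.refl _).prodCongr
    ((Equiv.sumArrowEquivProdArrow _ _ _).trans ((Equiv.curry _ _ _).prodCongr (Equiv.refl _))))

namespace FunFamily

variable (F : FunFamily) (l : ℕ)

/-- The decoder is run with uniform seeds and guesses. The factor `2` comes from the bound of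
`le_sum_decode`, and `2 ^ t` is the price of guessing the `t` parities. No test of the output is
needed: only the probability of a claw counts. -/
theorem exists_alg_advantage_le (hF : F.TrapdoorInjectivePair)
    (P : ClassicalProver (F.keyLen l) (F.imgLen l) (F.inLen l)) {t : ℕ} {δ : ℝ} (hδ : 0 < δ)
    (ht : 32 * ((F.inLen l + F.inLen l : ℝ) + 1) ≤ 2 ^ t * δ ^ 2) :
    ∃ A : ClassicalAlg (Fin (F.keyLen l)) (Fin (F.inLen l) ⊕ Fin (F.inLen l)),
      A.size ≤ 5 * P.size + P.size * t + t + 2 * (P.size * 2 ^ t * ((P.size + 2) * (t + 7)) +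
        P.size * ((2 ^ t + 1) + 2 ^ t * ((2 ^ t + 1) * 2))) + 1 ∧
      F.advantage l P.firstMessage P.guess ≤ δ / 2 + 2 * 2 ^ t * F.clawProb l A.prob := by
  classical
  obtain ⟨A, hsize, hA⟩ := Cost.exists_classicalAlg _ (P.cost_decoder t)
  refine ⟨A, hsize.trans ?_, ?_⟩
  · have h := P.le_size
    simp only [Fintype.card_sum, Fintype.card_fin, Fintype.card_prod]
    have h2 : t * (F.inLen l + F.inLen l) ≤ P.size * t := by
      rw [Nat.mul_comm]
      exact Nat.mul_le_mul_right _ (by omega)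
    omega
  rw [clawProb_eq, ← F.genAvg_const l (δ / 2), advantage, ← F.genAvg_const_mul, ← F.genAvg_add]
  refine F.genAvg_mono fun k τ hk => ?_
  let R := Fin (F.inLen l) ⊕ Fin (F.inLen l)
  let D := P.DecoderCoins t → Bool
  have hcardD : (2 : ℝ) ^ Fintype.card (P.DecoderCoins t) =
      2 ^ P.coins * (Fintype.card (Fin t → R → Bool) * 2 ^ t) := by
    have h := Fintype.card_congr (decoderCoinsEquiv (Fin P.coins) (Fin t) R)
    rw [Fintype.card_prod, Fintype.card_prod, Fintype.card_fun, Fintype.card_bool] at h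
    have h' : 2 ^ Fintype.card (P.DecoderCoins t) =
      2 ^ P.coins * (Fintype.card (Fin t → R → Bool) * 2 ^ t) := by
      refine h.trans ?_
      simp only [Fintype.card_fun (α := Fin P.coins), Fintype.card_fun (α := Fin t) (β := Bool),
        Fintype.card_bool, Fintype.card_fin]
    exact_mod_cast h'
  have hclaw : F.clawProbAt l k (A.prob k) = (∑ u : D, F.clawProbAt l k fun z =>
      if P.decoder t k u = z then 1 else 0) / 2 ^ Fintype.card (P.DecoderCoins t) := by
    rw [← clawProbAt_sum]
    have : A.prob k = fun z => (∑ u : D, if P.decoder t k u = z then (1 : ℝ) else 0) /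
        2 ^ Fintype.card (P.DecoderCoins t) := funext fun z => hA k z
    rw [this]
    simp only [clawProbAt, Finset.sum_div]
    refine Finset.sum_congr rfl fun x₀ _ => Finset.sum_congr rfl fun x₁ _ => ?_
    split_ifs
    · exact (Finset.sum_div _ _ _).symm
    · simp
  have hnonneg : ∀ u : D, ∀ z, (0 : ℝ) ≤ if P.decoder t k u = z then 1 else 0 :=
    fun u z => by split_ifs <;> norm_num
  have hcoin : ∀ c : Bits P.coins,
      (if ∃ x ∈ F.dom l k, F.f l k x = P.firstMessage k c then
        (∑ r, bsign (P.guess k c r) * parityChar r (F.invPair l τ (P.firstMessage k c))) /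
          2 ^ Fintype.card R else 0) ≤ δ / 2 + 2 / Fintype.card (Fin t → R → Bool) *
      ∑ S : Fin t → R → Bool, ∑ β : Fin t → Bool, F.clawProbAt l k fun z =>
        if P.decoder t k ((decoderCoinsEquiv _ _ _).symm (c, S, β)) = z then 1 else 0 := by
    intro c
    have hS : (0 : ℝ) < Fintype.card (Fin t → R → Bool) := by
      exact_mod_cast Fintype.card_pos
    split_ifs with hg
    · have h1 := le_sum_decode (ι := Fin t) (P.guess k c) (F.invPair l τ (P.firstMessage k c))
        (μ := (∑ r, bsign (P.guess k c r) * parityChar r (F.invPair l τ (P.firstMessage k c))) /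
          2 ^ Fintype.card R) hδ (by field_simp; rfl) (by simpa using ht)
      have h2 : ∑ S : Fin t → R → Bool, ∑ β : Fin t → Bool,
          (if decode (P.guess k c) S β = F.invPair l τ (P.firstMessage k c) then (1 : ℝ) else 0) ≤
          ∑ S : Fin t → R → Bool, ∑ β : Fin t → Bool, F.clawProbAt l k fun z =>
            if P.decoder t k ((decoderCoinsEquiv _ _ _).symm (c, S, β)) = z then 1 else 0 :=
        Finset.sum_le_sum fun S _ => Finset.sum_le_sum fun β _ =>
          F.le_clawProbAt (hnonneg ((decoderCoinsEquiv _ _ _).symm (c, S, β)))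
            (isClaw_inv hF hk hg)
      have h3 := h1.trans h2
      rw [← sub_le_iff_le_add', div_mul_eq_mul_div, le_div_iff₀ hS]
      linarith
    · have := Finset.sum_nonneg fun (S : Fin t → R → Bool) (_ : S ∈ Finset.univ) =>
        Finset.sum_nonneg fun (β : Fin t → Bool) (_ : β ∈ Finset.univ) => F.clawProbAt_nonneg
          (l := l) (k := k) (hnonneg ((decoderCoinsEquiv _ _ _).symm (c, S, β)))
      exact add_nonneg (half_pos hδ).le (mul_nonneg (div_nonneg zero_le_two hS.le) this)
  rw [hclaw, hcardD, ← (decoderCoinsEquiv _ _ _).symm.sum_comp, Fintype.sum_prod_type,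
    div_le_iff₀ (by positivity)]
  refine (Finset.sum_le_sum fun c _ => hcoin c).trans_eq ?_
  rw [Finset.sum_add_distrib, ← Finset.mul_sum, Finset.sum_const, Finset.card_univ,
    Fintype.card_fun (α := Fin P.coins), Fintype.card_bool, Fintype.card_fin, nsmul_eq_mul]
  simp only [Fintype.sum_prod_type]
  have hS : (0 : ℝ) < Fintype.card (Fin t → R → Bool) := by
    exact_mod_cast Fintype.card_pos
  push_cast
  field_simp
  rfl

theorem negligible_advantage_classical (hF : F.IsTCF .classical)
    (P : ∀ l, ClassicalProver (F.keyLen l) (F.imgLen l) (F.inLen l))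
    (hP : PolyBounded fun l => (P l).size) :
    Negligible fun l => max 0 (F.advantage l (P l).firstMessage (P l).guess) := by
  refine Negligible.of_le_inv_pow_add (fun l => le_max_left _ _) fun q => ?_
  -- For the accuracy `δ = (l + 1)⁻¹ ^ q` the decoder needs `2 ^ t ≥ 32 (2n + 1) / δ²`. Rounding up
  -- to a power of two at most doubles this, so `2 ^ t` stays polynomial.
  let x : ℕ → ℕ := fun l => 32 * (F.inLen l + F.inLen l + 1) * (l + 1) ^ (2 * q)
  let t : ℕ → ℕ := fun l => Nat.clog 2 (x l)
  have hx : ∀ l, 1 < x l := fun l => by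
    have : 0 < (l + 1) ^ (2 * q) := by positivity
    show 1 < 32 * (F.inLen l + F.inLen l + 1) * (l + 1) ^ (2 * q)
    nlinarith
  have hxt : ∀ l, x l ≤ 2 ^ t l := fun l => Nat.le_pow_clog one_lt_two _
  have htx : ∀ l, 2 ^ t l ≤ 2 * x l := fun l => by
    have h1 := Nat.pow_pred_clog_lt_self one_lt_two (hx l)
    have h2 : 0 < t l := Nat.clog_pos one_lt_two (hx l)
    have h3 : 2 ^ t l = 2 * 2 ^ (t l).pred := by
      rw [← pow_succ']
      exact congrArg _ (Nat.succ_pred_eq_of_pos h2).symm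
    rw [h3]
    exact Nat.mul_le_mul_left _ h1.le
  have hn : PolyBounded fun l => F.inLen l + F.inLen l :=
    hP.mono fun l => by have := (P l).le_size; omega
  have hM : PolyBounded fun l => 2 ^ t l :=
    PolyBounded.mono ((PolyBounded.const 2).mul (((PolyBounded.const 32).mul
      (hn.add (PolyBounded.const 1))).mul
        ((PolyBounded.id.add (PolyBounded.const 1)).pow (2 * q)))) htx
  have ht : PolyBounded t := hM.mono fun l => Nat.lt_two_pow_self.le
  have hδ : ∀ l : ℕ, (0 : ℝ) < ((l : ℝ) + 1)⁻¹ ^ q := fun l => by positivity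
  choose A hAsize hA using fun l => F.exists_alg_advantage_le l hF.trapdoorInjectivePair (P l)
    (t := t l) (hδ l) (by
      have h : ((x l : ℕ) : ℝ) ≤ ((2 ^ t l : ℕ) : ℝ) := Nat.cast_le.2 (hxt l)
      simp only [x] at h
      push_cast at h
      rw [← pow_mul, mul_comm q 2, inv_pow, ← div_eq_mul_inv, le_div_iff₀ (by positivity)]
      exact h)
  have hApoly : PolyBounded fun l => (A l).size := by
    refine PolyBounded.mono ?_ hAsize
    have c := PolyBounded.const
    exact (((((c 5).mul hP).add (hP.mul ht)).add ht).add ((c 2).mul (((hP.mul hM).mul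
      ((hP.add (c 2)).mul (ht.add (c 7)))).add (hP.mul ((hM.add (c 1)).add
        (hM.mul ((hM.add (c 1)).mul (c 2)))))))).add (c 1)
  have hclaw : Negligible fun l => F.clawProb l (A l).prob := hF.clawFree A hApoly
  refine ⟨_, Negligible.polyBounded_mul ((PolyBounded.const 2).mul hM) hclaw, fun l => ?_⟩
  have hc := hclaw.1 l
  refine max_le ?_ ((hA l).trans ?_)
  · have := hδ l
    positivity
  · have := hδ l
    push_cast
    linarith

theorem classical_soundness (hF : F.IsTCF .classical)
    (P : ∀ l, ClassicalProver (F.keyLen l) (F.imgLen l) (F.inLen l))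
    (hP : PolyBounded fun l => (P l).size) :
    ∃ ν : ℕ → ℝ, Negligible ν ∧ ∀ l, F.acceptProb l (P l).resp ≤ 3 / 4 + ν l :=
  ⟨_, (F.negligible_advantage_classical hF P hP).const_mul (by norm_num : (0 : ℝ) ≤ 1 / 4),
    fun l => (F.acceptProb_classical_le l (P l)).trans (by
      gcongr
      exact le_max_right _ _)⟩

end FunFamily

/-! ## Inner products, and inverses of quantum circuits -/

section QVec

variable {W : Type} [DecidableEq W] [Fintype W]

/-- The Hermitian inner product. -/
noncomputable def ip (φ ψ : QVec W) : ℂ := ∑ s, star (φ s) * ψ s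

theorem normSq_nonneg (ψ : QVec W) : 0 ≤ normSq ψ := Finset.sum_nonneg fun _ _ => sq_nonneg _

theorem re_ip_self (ψ : QVec W) : (ip ψ ψ).re = normSq ψ := by
  rw [ip, Complex.re_sum, normSq]
  refine Finset.sum_congr rfl fun s _ => ?_
  rw [Complex.sq_norm, Complex.normSq_apply]
  simp

theorem ip_comp_perm (σ : Equiv.Perm (W → Bool)) (φ ψ : QVec W) :
    ip (fun s => φ (σ s)) (fun s => ψ (σ s)) = ip φ ψ :=
  Equiv.sum_comp σ fun s => star (φ s) * ψ s

theorem normSq_comp_perm (σ : Equiv.Perm (W → Bool)) (ψ : QVec W) :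
    normSq (fun s => ψ (σ s)) = normSq ψ := by
  rw [← re_ip_self, ip_comp_perm, re_ip_self]

theorem ip_smul_right (c : ℂ) (φ ψ : QVec W) : ip φ (fun s => c * ψ s) = c * ip φ ψ := by
  simp only [ip, Finset.mul_sum]
  exact Finset.sum_congr rfl fun s _ => by ring

theorem ip_sum_right {ι : Type*} (I : Finset ι) (φ : QVec W) (ψ : ι → QVec W) :
    ip φ (fun s => ∑ i ∈ I, ψ i s) = ∑ i ∈ I, ip φ (ψ i) := by
  simp only [ip, Finset.mul_sum]
  exact Finset.sum_comm

/-- The squared norm of `a φ - b χ - c ω`, expanded, is nonnegative. -/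
theorem normSq_combination_nonneg (φ χ ω : QVec W) (a b c : ℝ) :
    0 ≤ a ^ 2 * normSq φ + b ^ 2 * normSq χ + c ^ 2 * normSq ω - 2 * a * b * (ip φ χ).re -
      2 * a * c * (ip φ ω).re + 2 * b * c * (ip χ ω).re := by
  simp only [normSq, ip, Complex.re_sum, Finset.mul_sum, ← Finset.sum_add_distrib,
    ← Finset.sum_sub_distrib]
  refine Finset.sum_nonneg fun s _ => ?_
  simp only [Complex.sq_norm, Complex.normSq_apply, Complex.star_def, Complex.mul_re,
    Complex.conj_re, Complex.conj_im]
  nlinarith [sq_nonneg (a * (φ s).re - b * (χ s).re - c * (ω s).re),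
    sq_nonneg (a * (φ s).im - b * (χ s).im - c * (ω s).im)]

/-- Cauchy-Schwarz in the form `‖a φ - χ‖² ≥ 0`. Being linear in the inner product, it can be summed
over messages and averaged over keys before `a` is chosen. -/
theorem two_mul_re_ip_le (φ χ : QVec W) (a : ℝ) :
    2 * a * (ip φ χ).re ≤ a ^ 2 * normSq φ + normSq χ := by
  have := normSq_combination_nonneg φ χ χ a 1 0
  linarith

theorem sum_normSq_project {J : Type} [DecidableEq J] [Fintype J] (reg : J → W) (ψ : QVec W) :
    ∑ v, normSq (project reg v ψ) = normSq ψ := by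
  simp only [normSq]
  rw [Finset.sum_comm]
  refine Finset.sum_congr rfl fun s _ => ?_
  rw [Finset.sum_eq_single fun j => s (reg j)]
  · simp [project]
  · intro v _ hv
    simp [project, hv.symm]
  · simp

theorem normSq_ket (s : W → Bool) : normSq (ket s) = 1 := by
  rw [normSq, Finset.sum_eq_single s]
  · simp [ket]
  · intro t _ ht
    simp [ket, ht]
  · simp

end QVec

namespace QGate

variable {W : Type} [DecidableEq W]

/-- The values of the two qubits of a gate. -/
def read (g : QGate W) (s : W → Bool) : Bool × Bool := (s g.fst, s g.snd)

/-- Replacement of the values of the two qubits of a gate. -/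
def write (g : QGate W) (s : W → Bool) (v : Bool × Bool) : W → Bool :=
  Function.update (Function.update s g.fst v.1) g.snd v.2

theorem apply_eq (g : QGate W) (ψ : QVec W) (s : W → Bool) :
    g.apply ψ s = ∑ v, g.U.1 (g.read s) v * ψ (g.write s v) := rfl

theorem read_write (g : QGate W) (s : W → Bool) (v : Bool × Bool) : g.read (g.write s v) = v := by
  simp [read, write, Function.update_of_ne g.ne]

theorem write_write (g : QGate W) (s : W → Bool) (v w : Bool × Bool) :
    g.write (g.write s v) w = g.write s w := by
  funext i
  by_cases h : i = g.snd
  · subst h; simp [write]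
  · by_cases h' : i = g.fst
    · subst h'; simp [write, h]
    · simp [write, h, h']

theorem write_read (g : QGate W) (s : W → Bool) : g.write s (g.read s) = s := by
  simp [read, write]

/-- The inverse gate. -/
def inv {W : Type} (g : QGate W) : QGate W := { g with U := g.U⁻¹ }

theorem inv_apply_apply (g : QGate W) (ψ : QVec W) : g.inv.apply (g.apply ψ) = ψ := by
  funext s
  have hw : ∀ s v, g.inv.write s v = g.write s v := fun _ _ => rfl
  have hr : ∀ s, g.inv.read s = g.read s := fun _ => rfl
  simp only [apply_eq, hw, hr, read_write, write_write, Finset.mul_sum]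
  rw [Finset.sum_comm]
  have h : ∀ w, ∑ v, g.inv.U.1 (g.read s) v * (g.U.1 v w * ψ (g.write s w)) =
      (1 : Matrix (Bool × Bool) (Bool × Bool) ℂ) (g.read s) w * ψ (g.write s w) := fun w => by
    have h1 : g.inv.U.1 * g.U.1 = 1 := by
      rw [← Submonoid.coe_mul]
      simp [inv]
    rw [← h1, Matrix.mul_apply, Finset.sum_mul]
    exact Finset.sum_congr rfl fun v _ => by ring
  rw [Finset.sum_congr rfl fun w _ => h w]
  simp [Matrix.one_apply, write_read]

theorem ip_apply [Fintype W] (g : QGate W) (φ ψ : QVec W) :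
    ip φ (g.apply ψ) = ip (g.inv.apply φ) ψ := by
  have hw : ∀ s v, g.inv.write s v = g.write s v := fun _ _ => rfl
  have hr : ∀ s, g.inv.read s = g.read s := fun _ => rfl
  simp only [ip, apply_eq, hw, hr, star_sum, Finset.mul_sum, Finset.sum_mul]
  rw [← Fintype.sum_prod_type', ← Fintype.sum_prod_type']
  -- Exchanging the values stored on the two qubits with the summation index interchanges the two
  -- sides, with `U` turned into its conjugate transpose.
  have hinv : Function.Involutive
      fun p : (W → Bool) × (Bool × Bool) => (g.write p.1 p.2, g.read p.1) := fun p => by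
    simp [read_write, write_write, write_read]
  rw [← Equiv.sum_comp (hinv.toPerm _)]
  refine Finset.sum_congr rfl fun p _ => ?_
  have hU : ∀ v w, g.inv.U.1 v w = star (g.U.1 w v) := fun v w => rfl
  simp only [Function.Involutive.coe_toPerm, read_write, write_write, write_read, hU, star_mul',
    star_star]
  ring

end QGate

section Circuits

/-- The inverse circuit. -/
def invQ {W : Type} (C : List (QGate W)) : List (QGate W) := (C.map QGate.inv).reverse

theorem length_invQ {W : Type} (C : List (QGate W)) : (invQ C).length = C.length := by
  simp [invQ]

variable {W : Type} [DecidableEq W]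

theorem runQ_append (C D : List (QGate W)) (ψ : QVec W) :
    runQ (C ++ D) ψ = runQ D (runQ C ψ) := by
  simp [runQ]

theorem runQ_cons (g : QGate W) (C : List (QGate W)) (ψ : QVec W) :
    runQ (g :: C) ψ = runQ C (g.apply ψ) := rfl

theorem runQ_invQ_runQ (C : List (QGate W)) (ψ : QVec W) : runQ (invQ C) (runQ C ψ) = ψ := by
  induction C generalizing ψ with
  | nil => rfl
  | cons g C ih =>
    have : invQ (g :: C) = invQ C ++ [g.inv] := by simp [invQ]
    rw [this, runQ_append, runQ_cons g C, ih]
    exact g.inv_apply_apply ψ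

theorem ip_runQ [Fintype W] (C : List (QGate W)) (φ ψ : QVec W) :
    ip φ (runQ C ψ) = ip (runQ (invQ C) φ) ψ := by
  induction C generalizing φ ψ with
  | nil => rfl
  | cons g C ih =>
    have : invQ (g :: C) = invQ C ++ [g.inv] := by simp [invQ]
    rw [this, runQ_append, runQ_cons, ih, g.ip_apply]
    rfl

theorem ip_runQ_runQ [Fintype W] (C : List (QGate W)) (φ ψ : QVec W) :
    ip (runQ C φ) (runQ C ψ) = ip φ ψ := by
  rw [ip_runQ, runQ_invQ_runQ]

theorem ip_runQ_invQ [Fintype W] (C : List (QGate W)) (φ ψ : QVec W) :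
    ip φ (runQ (invQ C) ψ) = ip (runQ C φ) ψ := by
  rw [ip_runQ]
  congr 1
  have : invQ (invQ C) = C := by
    have h : ∀ g : QGate W, g.inv.inv = g := fun g => by simp [QGate.inv]
    simp [invQ, List.map_reverse, Function.comp_def, h]
  rw [this]

theorem normSq_runQ [Fintype W] (C : List (QGate W)) (ψ : QVec W) :
    normSq (runQ C ψ) = normSq ψ := by
  rw [← re_ip_self, ip_runQ_runQ, re_ip_self]

theorem runQ_smul (C : List (QGate W)) (c : ℂ) (ψ : QVec W) :
    runQ C (fun s => c * ψ s) = fun s => c * runQ C ψ s := by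
  induction C generalizing ψ with
  | nil => rfl
  | cons g C ih =>
    rw [runQ_cons, runQ_cons, ← ih]
    congr 1
    funext s
    simp only [QGate.apply_eq, Finset.mul_sum]
    exact Finset.sum_congr rfl fun v _ => by ring

/-! ## Renaming of wires -/

variable {V : Type} [DecidableEq V]

/-- A gate acting on renamed wires. -/
def QGate.rename (e : V ↪ W) (g : QGate V) : QGate W :=
  ⟨g.U, e g.fst, e g.snd, fun h => g.ne (e.injective h)⟩

/-- A renamed circuit acts separately on the slices of a vector, in which all wires outside the
range of the renaming are fixed. -/
theorem slice_runQ (e : V ↪ W) (C : List (QGate V)) (ψ : QVec W) (s : W → Bool) :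
    (fun u => runQ (C.map (QGate.rename e)) ψ (Function.extend e u s)) =
      runQ C (fun u => ψ (Function.extend e u s)) := by
  induction C generalizing ψ with
  | nil => rfl
  | cons g C ih =>
    rw [List.map_cons, runQ_cons, runQ_cons]
    refine (ih _).trans (congrArg _ (funext fun u => ?_))
    have hx : ∀ (u : V → Bool) i, Function.extend e u s (e i) = u i :=
      fun u i => e.injective.extend_apply u s i
    have hw : ∀ v, (g.rename e).write (Function.extend e u s) v =
        Function.extend e (g.write u v) s := fun v => by
      funext i
      by_cases hi : ∃ j, e j = i
      · obtain ⟨j, rfl⟩ := hi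
        rw [hx]
        simp [QGate.write, QGate.rename, Function.update_apply, hx, e.injective.eq_iff]
      · rw [Function.extend_apply' _ _ _ hi]
        have h1 : i ≠ e g.fst := fun h => hi ⟨_, h.symm⟩
        have h2 : i ≠ e g.snd := fun h => hi ⟨_, h.symm⟩
        simp [QGate.write, QGate.rename, h1, h2,
          Function.extend_apply' _ _ _ hi]
    rw [QGate.apply_eq, QGate.apply_eq]
    refine Finset.sum_congr rfl fun v _ => ?_
    rw [hw]
    simp [QGate.read, QGate.rename, hx]

end Circuits

/-! ## Some gates -/

section Gates

variable {W : Type} [DecidableEq W]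

/-- The gate permuting the basis vectors of two qubits. -/
def permGate (σ : Equiv.Perm (Bool × Bool)) (i j : W) (h : i ≠ j) : QGate W where
  U := ⟨Matrix.of fun a b => if b = σ a then 1 else 0, by
    rw [Matrix.mem_unitaryGroup_iff]
    ext a b
    simp [Matrix.mul_apply, Matrix.one_apply, eq_comm]⟩
  fst := i
  snd := j
  ne := h

theorem permGate_apply (σ : Equiv.Perm (Bool × Bool)) (i j : W) (h : i ≠ j) (ψ : QVec W)
    (s : W → Bool) : (permGate σ i j h).apply ψ s =
      ψ (Function.update (Function.update s i (σ (s i, s j)).1) j (σ (s i, s j)).2) := by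
  simp [QGate.apply, permGate]

/-- Addition of the first bit to the second. -/
def cnotPerm : Equiv.Perm (Bool × Bool) :=
  Function.Involutive.toPerm (fun p => (p.1, xor p.2 p.1)) fun p => by simp

theorem cnotPerm_apply (p : Bool × Bool) : cnotPerm p = (p.1, xor p.2 p.1) := rfl

/-- The controlled-not gate. -/
def cnot (i j : W) (h : i ≠ j) : QGate W := permGate cnotPerm i j h

theorem cnot_apply (i j : W) (h : i ≠ j) (ψ : QVec W) (s : W → Bool) :
    (cnot i j h).apply ψ s = ψ (Function.update s j (xor (s j) (s i))) := by
  simp [cnot, permGate_apply, cnotPerm_apply]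

/-- Negation of the first bit. -/
def notPerm : Equiv.Perm (Bool × Bool) :=
  Function.Involutive.toPerm (fun p => (!p.1, p.2)) fun p => by simp

theorem notPerm_apply (p : Bool × Bool) : notPerm p = (!p.1, p.2) := rfl

/-- The not gate on the wire `i`; the wire `j` is idle. -/
def notGate (i j : W) (h : i ≠ j) : QGate W := permGate notPerm i j h

theorem notGate_apply (i j : W) (h : i ≠ j) (ψ : QVec W) (s : W → Bool) :
    (notGate i j h).apply ψ s = ψ (Function.update s i (!s i)) := by
  rw [notGate, permGate_apply]
  congr 1
  funext w
  by_cases hw : w = j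
  · subst hw; simp [notPerm_apply, Function.update_of_ne h.symm]
  · simp [notPerm_apply, hw, Function.update_apply]

/-- The phase flip of the wire `i`; the wire `j` is idle. -/
noncomputable def phaseGate (i j : W) (h : i ≠ j) : QGate W where
  U := ⟨Matrix.diagonal fun a => (bsign a.1 : ℂ), by
    rw [Matrix.mem_unitaryGroup_iff, Matrix.star_eq_conjTranspose, Matrix.diagonal_conjTranspose,
      Matrix.diagonal_mul_diagonal, ← Matrix.diagonal_one]
    congr 1
    funext a
    rcases a with ⟨_ | _, _⟩ <;> simp⟩
  fst := i
  snd := j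
  ne := h

theorem phaseGate_apply (i j : W) (h : i ≠ j) (ψ : QVec W) (s : W → Bool) :
    (phaseGate i j h).apply ψ s = bsign (s i) * ψ s := by
  simp only [QGate.apply, phaseGate, Matrix.diagonal_apply]
  simp

/-- The amplitude `1/√2`. -/
noncomputable def hadamardScale : ℂ := ((Real.sqrt 2)⁻¹ : ℝ)

theorem hadamardScale_mul_self : hadamardScale * hadamardScale = 1 / 2 := by
  rw [hadamardScale, ← Complex.ofReal_mul, ← mul_inv, Real.mul_self_sqrt zero_le_two]
  norm_num

theorem conj_hadamardScale : (starRingEnd ℂ) hadamardScale = hadamardScale := Complex.conj_ofReal _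

/-- The Hadamard gate on the wire `i`; the wire `j` is idle. -/
noncomputable def hadamardGate (i j : W) (h : i ≠ j) : QGate W where
  U := ⟨Matrix.of fun a b => if a.2 = b.2 then hadamardScale * bsign (b.1 && a.1) else 0, by
    rw [Matrix.mem_unitaryGroup_iff]
    have hs := hadamardScale_mul_self
    ext a b
    rw [Matrix.mul_apply, Fintype.sum_prod_type]
    rcases a with ⟨_ | _, _ | _⟩ <;> rcases b with ⟨_ | _, _ | _⟩ <;>
      simp [conj_hadamardScale, bsign, hs] <;> norm_num⟩
  fst := i
  snd := j
  ne := h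

theorem hadamardGate_apply (i j : W) (h : i ≠ j) (ψ : QVec W) (s : W → Bool) :
    (hadamardGate i j h).apply ψ s =
      hadamardScale * ∑ v : Bool, bsign (v && s i) * ψ (Function.update s i v) := by
  have hu : ∀ v, Function.update (Function.update s i v) j (s j) = Function.update s i v :=
    fun v => by
      conv_lhs => rw [show s j = Function.update s i v j by rw [Function.update_of_ne h.symm]]
      exact Function.update_eq_self _ _
  simp only [QGate.apply, hadamardGate, Matrix.of_apply, Fintype.sum_prod_type, ite_mul, zero_mul,
    Finset.sum_ite_eq, Finset.mem_univ, if_true, hu, Finset.mul_sum, mul_assoc]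

/-- Copying the wires `src i` to the wires `dst i`. -/
theorem runQ_copy {ι : Type} (src dst : ι → W) (h : ∀ i j, src i ≠ dst j)
    (hdst : Function.Injective dst) (l : List ι) (hl : l.Nodup) (ψ : QVec W) (s s' : W → Bool)
    (h1 : ∀ i ∈ l, s' (dst i) = xor (s (dst i)) (s (src i)))
    (h2 : ∀ w, (∀ i ∈ l, w ≠ dst i) → s' w = s w) :
    runQ (l.map fun i => cnot (src i) (dst i) (h i i)) ψ s = ψ s' := by
  induction l generalizing ψ s' with
  | nil => exact congrArg ψ (funext fun w => (h2 w (by simp)).symm)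
  | cons i l ih =>
    -- Gates act on vectors by substitution, so the first gate of the list acts last on the
    -- assignment. Before it, every copy but the one to `dst i` has been made.
    rw [List.map_cons, runQ_cons, ih (List.nodup_cons.1 hl).2 _ (Function.update s' (dst i) (s (dst i)))]
    · rw [cnot_apply]
      congr 1
      funext w
      by_cases hw : w = dst i
      · subst hw
        simp only [Function.update_self, Function.update_of_ne (h i i)]
        rw [h1 i (by simp), h2 _ fun j _ => h i j]
      · simp [hw]
    · intro j hj
      have hne : dst j ≠ dst i := fun he => (List.nodup_cons.1 hl).1 (hdst he ▸ hj)
      rw [Function.update_of_ne hne, h1 j (by simp [hj])]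
    · intro w hw
      by_cases hwi : w = dst i
      · subst hwi; simp
      · rw [Function.update_of_ne hwi]
        exact h2 w fun j hj => by
          rcases List.mem_cons.1 hj with rfl | hj
          · exact hwi
          · exact hw j hj

/-- Reindexing for one further Hadamard gate: a string pinned at `i`, together with a free bit `v`,
is the same as a string that is free at `i`. -/
theorem sum_sum_update {R : Type} [DecidableEq R] [Fintype R] {M : Type*} [AddCommMonoid M] (i : R)
    (b : Bool) (Q : (R → Bool) → Prop) [DecidablePred Q] (hQ : ∀ r v, Q (Function.update r i v) ↔ Q r)
    (f : (R → Bool) → M) :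
    (∑ r, ∑ v, if r i = b ∧ Q r then f (Function.update r i v) else 0) =
      ∑ r, if Q r then f r else 0 := by
  rw [← Fintype.sum_prod_type', ← Finset.sum_filter, ← Finset.sum_filter]
  refine Finset.sum_nbij' (fun p => Function.update p.1 i p.2)
    (fun r => (Function.update r i b, r i)) ?_ ?_ ?_ ?_ ?_
  · rintro ⟨r, v⟩ hp
    simpa [hQ] using (Finset.mem_filter.1 hp).2.2
  · intro r hr
    simpa [hQ] using (Finset.mem_filter.1 hr).2
  · rintro ⟨r, v⟩ hp
    have := (Finset.mem_filter.1 hp).2.1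
    simp only at this
    subst this
    simp
  · intro r _
    simp
  · rintro ⟨r, v⟩ _
    rfl

/-- Hadamard gates on the wires `e i`, with the idle wire `j`. -/
theorem runQ_hadamard {R : Type} [DecidableEq R] [Fintype R] (e : R ↪ W) (j : W)
    (h : ∀ i, e i ≠ j) (l : List R) (hl : l.Nodup) (ψ : QVec W) (s : W → Bool) :
    runQ (l.map fun i => hadamardGate (e i) j (h i)) ψ s =
      hadamardScale ^ l.length * ∑ r : R → Bool, if ∀ i, i ∉ l → r i = s (e i) then
        (l.map fun i => (bsign (r i && s (e i)) : ℂ)).prod * ψ (Function.extend e r s) else 0 := by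
  induction l generalizing ψ with
  | nil =>
    rw [Finset.sum_eq_single (s ∘ e)]
    · have : Function.extend e (s ∘ e) s = s := by
        funext w
        by_cases hw : ∃ i, e i = w
        · obtain ⟨i, rfl⟩ := hw
          simp [e.injective.extend_apply]
        · rw [Function.extend_apply' _ _ _ hw]
      simp [runQ, this]
    · intro r _ hr
      rw [if_neg fun hr' => hr (funext fun i => hr' i (by simp))]
    · simp
  | cons i l ih =>
    obtain ⟨hi, hl⟩ := List.nodup_cons.1 hl
    rw [List.map_cons, runQ_cons, ih hl]
    have hext : ∀ (r : R → Bool) v, Function.update (Function.extend e r s) (e i) v =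
        Function.extend e (Function.update r i v) s := fun r v => by
      funext w
      by_cases hw : ∃ k, e k = w
      · obtain ⟨k, rfl⟩ := hw
        simp [Function.update_apply, e.injective.extend_apply]
      · have : w ≠ e i := fun h => hw ⟨i, h.symm⟩
        rw [Function.update_of_ne this, Function.extend_apply' _ _ _ hw,
          Function.extend_apply' _ _ _ hw]
    have hprod : ∀ (r : R → Bool) v, (l.map fun k => (bsign (Function.update r i v k && s (e k)) : ℂ)) =
        l.map fun k => (bsign (r k && s (e k)) : ℂ) := fun r v =>
      List.map_congr_left fun k hk => by
        rw [Function.update_of_ne (show k ≠ i from fun h => hi (h ▸ hk))]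
    rw [List.length_cons, pow_succ, mul_assoc]
    congr 1
    rw [← sum_sum_update i (s (e i)) (fun r => ∀ k, k ∉ i :: l → r k = s (e k)), Finset.mul_sum]
    · refine Finset.sum_congr rfl fun r _ => ?_
      have hiff : (∀ k, k ∉ l → r k = s (e k)) ↔
          r i = s (e i) ∧ ∀ k, k ∉ i :: l → r k = s (e k) := by
        constructor
        · exact fun hr => ⟨hr i hi, fun k hk => hr k fun h => hk (List.mem_cons_of_mem _ h)⟩
        · rintro ⟨h1, h2⟩ k hk
          by_cases hki : k = i
          · subst hki; exact h1
          · exact h2 k (by simp [hki, hk])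
      simp only [hiff]
      split_ifs with hr
      · rw [hadamardGate_apply]
        simp only [hext, e.injective.extend_apply, hr.1, List.map_cons, List.prod_cons, hprod,
          Function.update_self, Finset.mul_sum]
        exact Finset.sum_congr rfl fun v _ => by ring
      · simp
    · intro r v
      refine forall_congr' fun k => imp_congr_right fun hk => ?_
      rw [Function.update_of_ne (show k ≠ i from fun h => hk (h ▸ List.mem_cons_self))]

end Gates

/-! ## Quantum algorithms on arbitrary wires -/

/-- A circuit on wires that include input and output wires is a quantum algorithm. -/
theorem exists_quantumAlg {W I O : Type} [DecidableEq W] [Fintype W] [DecidableEq I] [Fintype I]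
    [DecidableEq O] [Fintype O] (inp : I → W) (out : O → W)
    (hinj : Function.Injective (Sum.elim inp out)) (C : List (QGate W)) :
    ∃ A : QuantumAlg I O, A.size = Fintype.card W + C.length ∧
      ∀ (x : I → Bool) (z : O → Bool) (s : W → Bool), (∀ i, s (inp i) = x i) →
        (∀ w, (∀ i, w ≠ inp i) → s w = false) →
        A.prob x z = normSq (project out z (runQ C (ket s))) := by
  classical
  let T := {w // w ∉ Set.range (Sum.elim inp out)}
  let eT := Fintype.equivFin T
  let φ : AlgWire I O (Fin (Fintype.card T)) → W :=
    Sum.elim inp (Sum.elim out fun j => (eT.symm j).1)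
  have hφ : Function.Bijective φ := by
    constructor
    · have hI : ∀ i (t : T), inp i ≠ t.1 := fun i t h => t.2 ⟨Sum.inl i, h⟩
      have hO : ∀ o (t : T), out o ≠ t.1 := fun o t h => t.2 ⟨Sum.inr o, h⟩
      have hne : ∀ i o, inp i ≠ out o := fun i o h => by
        have := @hinj (Sum.inl i) (Sum.inr o) h
        simp at this
      rintro (i | o | j) (i' | o' | j') h
      · exact congrArg _ (Sum.inl_injective (hinj (a₁ := Sum.inl i) (a₂ := Sum.inl i') h))
      · exact absurd h (hne i o')
      · exact absurd h (hI i _)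
      · exact absurd h.symm (hne i' o)
      · have := Sum.inr_injective (hinj (a₁ := Sum.inr o) (a₂ := Sum.inr o') h)
        rw [this]
      · exact absurd h (hO o _)
      · exact absurd h.symm (hI i' _)
      · exact absurd h.symm (hO o' _)
      · have := eT.symm.injective (Subtype.ext h)
        rw [this]
    · intro w
      by_cases hw : w ∈ Set.range (Sum.elim inp out)
      · obtain ⟨i | o, h⟩ := hw
        · exact ⟨Sum.inl i, h⟩
        · exact ⟨Sum.inr (Sum.inl o), h⟩
      · exact ⟨Sum.inr (Sum.inr (eT ⟨w, hw⟩)), by simp [φ]⟩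
  let ε : AlgWire I O (Fin (Fintype.card T)) ≃ W := Equiv.ofBijective φ hφ
  refine ⟨⟨Fintype.card T, C.map (QGate.rename ε.symm.toEmbedding)⟩, ?_, fun x z s hs hs' => ?_⟩
  · simp only [QuantumAlg.size, List.length_map, Fintype.card_congr ε]
  · have hket : ∀ u : W → Bool,
        ket (algInit x fun _ => false) (u ∘ ε) = (ket s u : ℂ) := fun u => by
      have h : u ∘ ε = algInit x (fun _ => false) ↔ u = s := by
        have h1 : s ∘ ε = algInit x (fun _ => false) := by
          funext w
          rcases w with i | o | j
          · exact hs i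
          · exact hs' _ fun i h => by
              have := @hinj (Sum.inr o) (Sum.inl i) h
              simp at this
          · exact hs' _ fun i h => (eT.symm j).2 ⟨Sum.inl i, h.symm⟩
        rw [← h1]
        exact ⟨fun h => ε.surjective.injective_comp_right h, fun h => by rw [h]⟩
      simp [ket, h]
    have hext : ∀ (u : W → Bool) s', Function.extend ε.symm.toEmbedding u s' = u ∘ ε :=
      fun u s' => by
        funext w
        conv_lhs => rw [← ε.symm_apply_apply w]
        exact ε.symm.injective.extend_apply _ _ _
    have hrun := slice_runQ ε.symm.toEmbedding C (ket (algInit x fun _ => false)) (fun _ => false)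
    simp only [hext, hket] at hrun
    rw [QuantumAlg.prob, QuantumAlg.final, normSq, normSq]
    rw [← Equiv.sum_comp (Equiv.arrowCongr ε.symm (Equiv.refl Bool))]
    refine Finset.sum_congr rfl fun u _ => ?_
    have h1 : (Equiv.arrowCongr ε.symm (Equiv.refl Bool)) u = u ∘ ε := rfl
    rw [h1, project, project]
    have h2 := congrFun hrun u
    rw [h2]
    rfl

/-! ### Arrivals of messages as involutions of the basis -/

namespace ProverWire

variable {a v n : ℕ} {T : Type}

/-- The arrival of the second message, as a permutation. -/
def loadRPerm (r : Fin n ⊕ Fin n → Bool) : Equiv.Perm (ProverWire a v n T → Bool) :=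
  Function.Involutive.toPerm (loadR (r ∘ Sum.inl) (r ∘ Sum.inr)) fun s => by
    funext w
    cases w <;> simp [loadR]

theorem loadRPerm_apply (r : Fin n ⊕ Fin n → Bool) (s : ProverWire a v n T → Bool) :
    loadRPerm r s = loadR (r ∘ Sum.inl) (r ∘ Sum.inr) s := rfl

/-- The arrival of the challenge, as a permutation. -/
def loadMPerm (m : Bool) : Equiv.Perm (ProverWire a v n T → Bool) :=
  Function.Involutive.toPerm (loadM m) fun s => by
    funext w
    cases w <;> simp [loadM]

theorem loadMPerm_apply (m : Bool) (s : ProverWire a v n T → Bool) :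
    loadMPerm m s = loadM m s := rfl

theorem loadM_loadM (m : Bool) (s : ProverWire a v n T → Bool) : loadM m (loadM m s) = s :=
  (loadMPerm m).left_inv s

theorem loadR_loadR (r : Fin n ⊕ Fin n → Bool) (s : ProverWire a v n T → Bool) :
    loadR (r ∘ Sum.inl) (r ∘ Sum.inr) (loadR (r ∘ Sum.inl) (r ∘ Sum.inr) s) = s :=
  (loadRPerm r).left_inv s

end ProverWire

/-! ## The prover's observables -/

namespace QuantumProver

variable {a v n : ℕ} (P : QuantumProver a v n)

/-- The wires of the prover. -/
abbrev Wire : Type := ProverWire a v n (Fin P.work)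

/-- The circuit adding `m` to the register of the challenge. -/
def challenge (m : Bool) : List (QGate P.Wire) :=
  if m then [notGate .chal .ans (by simp)] else []

theorem runQ_challenge (m : Bool) (ψ : QVec P.Wire) :
    runQ (P.challenge m) ψ = fun s => ψ (ProverWire.loadM m s) := by
  funext s
  cases m
  · show ψ s = _
    congr 1
    funext w
    cases w <;> simp [ProverWire.loadM]
  · show (notGate _ _ _).apply ψ s = _
    rw [notGate_apply]
    congr 1
    funext w
    cases w <;> simp [ProverWire.loadM]

/-- The circuit of the observable that is measured upon the challenge `m`. -/
noncomputable def observable (m : Bool) : List (QGate P.Wire) :=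
  -- The challenge circuit is its own inverse, so this is the phase flip of the answer wire
  -- conjugated by the third round.
  P.challenge m ++ (P.round₃ ++ (phaseGate .ans .chal (by simp) :: (invQ P.round₃ ++ P.challenge m)))

/-- The vector before the last measurement. -/
def final (m : Bool) (φ : QVec P.Wire) : QVec P.Wire :=
  runQ P.round₃ fun s => φ (ProverWire.loadM m s)

theorem normSq_final (m : Bool) (φ : QVec P.Wire) : normSq (P.final m φ) = normSq φ := by
  rw [final, normSq_runQ]
  exact normSq_comp_perm (ProverWire.loadMPerm m) φ

theorem ip_observable (m : Bool) (φ : QVec P.Wire) :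
    ip φ (runQ (P.observable m) φ) =
      ip (P.final m φ) fun s => bsign (s .ans) * P.final m φ s := by
  rw [observable, runQ_append, runQ_append, runQ_cons, runQ_append, runQ_challenge, runQ_challenge]
  have h : ∀ ψ : QVec P.Wire, ip φ (fun s => ψ (ProverWire.loadM m s)) =
      ip (fun s => φ (ProverWire.loadM m s)) ψ := fun ψ => by
    rw [← ip_comp_perm (ProverWire.loadMPerm m) φ]
    simp only [ProverWire.loadMPerm_apply, ProverWire.loadM_loadM]
  rw [h, ip_runQ_invQ]
  congr 1
  funext s
  rw [phaseGate_apply]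
  rfl

/-- The projection on the answer `b` is `(1 + (-1)^b Z)/2`, with `Z` the phase flip of the answer
wire. -/
theorem normSq_project_ans (b : Bool) (χ : QVec P.Wire) :
    normSq (project (fun _ : Unit => ProverWire.ans) (fun _ => b) χ) =
      1 / 2 * normSq χ + 1 / 2 * bsign b * (ip χ fun s => bsign (s .ans) * χ s).re := by
  simp only [normSq, ip, Complex.re_sum, Finset.mul_sum, ← Finset.sum_add_distrib]
  refine Finset.sum_congr rfl fun s _ => ?_
  have h : (star (χ s) * ((bsign (s .ans) : ℝ) * χ s)).re = bsign (s .ans) * ‖χ s‖ ^ 2 := by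
    rw [Complex.sq_norm, Complex.normSq_apply]
    simp
    ring
  have hiff : (fun _ : Unit => s ProverWire.ans) = (fun _ => b) ↔ s .ans = b :=
    ⟨fun h => congrFun h (), fun h => by rw [h]⟩
  rw [h, project]
  simp only [hiff]
  cases s .ans <;> cases b <;> simp <;> ring

/-- The correlation of the answers to the two challenges, in the state `φ`. -/
noncomputable def correlation (φ : QVec P.Wire) : ℂ :=
  ip (runQ (P.observable false) φ) (runQ (P.observable true) φ)

/-- Expansion of `‖√2 φ - (-1)^(c 0) O₀φ - (-1)^(c 1) O₁φ‖² ≥ 0`. The weight `√2` is optimal when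
`O₀φ` and `O₁φ` are orthogonal, which produces the value `cos²(π/8)`. -/
theorem sum_normSq_correct_le (φ : QVec P.Wire) (c : Bool → Bool) :
    ∑ m, normSq (project (fun _ : Unit => ProverWire.ans) (fun _ => c m) (P.final m φ)) ≤
      (1 + Real.sqrt 2 / 2) * normSq φ +
        Real.sqrt 2 / 4 * (bsign (xor (c false) (c true)) * (P.correlation φ).re) := by
  have h := normSq_combination_nonneg φ (runQ (P.observable false) φ) (runQ (P.observable true) φ)
    (Real.sqrt 2) (bsign (c false)) (bsign (c true))
  have h0 := bsign_mul_self (c false)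
  have h1 := bsign_mul_self (c true)
  have h2 := Real.mul_self_sqrt (zero_le_two (α := ℝ))
  have h3 : 0 < Real.sqrt 2 := by positivity
  simp only [normSq_runQ, sq, h0, h1, h2] at h
  rw [Fintype.sum_bool, normSq_project_ans, normSq_project_ans, normSq_final, normSq_final,
    ← ip_observable, ← ip_observable, bsign_xor, correlation]
  generalize (ip φ (runQ (P.observable false) φ)).re = x at *
  generalize (ip φ (runQ (P.observable true) φ)).re = y at *
  generalize (ip (runQ (P.observable false) φ) (runQ (P.observable true) φ)).re = z at *
  generalize normSq φ = w at *
  generalize bsign (c false) = p at *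
  generalize bsign (c true) = q at *
  have h4 : Real.sqrt 2 * (p * x + q * y) ≤ Real.sqrt 2 * (Real.sqrt 2 * (w + p * q * z / 2)) := by
    rw [← mul_assoc, h2]
    linarith
  have h5 := le_of_mul_le_mul_left h4 h3
  linarith

theorem sum_normSq_state₂ (k : Bits a) (r₀ r₁ : Bits n) (y : Bits v) :
    ∑ d, normSq (P.state₂ k r₀ r₁ y d) = normSq (P.state₁ k y) := by
  simp only [state₂]
  rw [sum_normSq_project, normSq_runQ]
  exact normSq_comp_perm (ProverWire.loadRPerm (Sum.elim r₀ r₁)) (P.state₁ k y)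

theorem sum_normSq_state₁ (k : Bits a) : ∑ y, normSq (P.state₁ k y) = 1 := by
  simp only [state₁]
  rw [sum_normSq_project, normSq_runQ, normSq_ket]

end QuantumProver

namespace FunFamily

variable (F : FunFamily) (l : ℕ)

/-- The correlation of the answers of the prover, whose first message is `y`, with the parity of
the coordinates of the preimages of `y` that are selected by a random string. -/
noncomputable def quantumBias (P : QuantumProver (F.keyLen l) (F.imgLen l) (F.inLen l))
    (k : Bits (F.keyLen l)) (t : Bits (F.tdLen l)) (y : Bits (F.imgLen l)) : ℝ :=
  (∑ r, parityChar r (F.invPair l t y) *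
    ∑ d, (P.correlation (P.state₂ k (r ∘ Sum.inl) (r ∘ Sum.inr) y d)).re) /
      2 ^ Fintype.card (Fin (F.inLen l) ⊕ Fin (F.inLen l))

open Classical in
/-- The bias, averaged over the keys and the first messages. -/
noncomputable def quantumAdvantage
    (P : QuantumProver (F.keyLen l) (F.imgLen l) (F.inLen l)) : ℝ :=
  F.genAvg l fun k t => ∑ y, if ∃ x ∈ F.dom l k, F.f l k x = y then F.quantumBias l P k t y else 0

/-- The state before the challenge does not depend on `m`, so `sum_normSq_correct_le` applies for
each `y, d`. The sign of `c 0 ⊕ c 1` is the parity character for every `d`, which lets the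
correlations be summed over `d`. -/
theorem acceptProb_quantum_le (P : QuantumProver (F.keyLen l) (F.imgLen l) (F.inLen l)) :
    F.acceptProb l P.resp ≤
      (1 / 2 + Real.sqrt 2 / 4) + Real.sqrt 2 / 8 * F.quantumAdvantage l P := by
  classical
  rw [← F.genAvg_const l (1 / 2 + Real.sqrt 2 / 4), quantumAdvantage, ← F.genAvg_const_mul,
    ← F.genAvg_add]
  refine F.genAvg_mono fun k t _ => ?_
  set N : ℝ := 2 ^ F.inLen l with hN
  have hNpos : 0 < N := by positivity
  have hcard : (2 : ℝ) ^ Fintype.card (Fin (F.inLen l) ⊕ Fin (F.inLen l)) = N * N := by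
    rw [Fintype.card_sum, Fintype.card_fin, pow_add]
  have hmsg : ∀ y, ∑ r₀ : Bits (F.inLen l), ∑ r₁ : Bits (F.inLen l), ∑ d : Bits (F.inLen l),
      ∑ m : Bool, ∑ b : Bool,
        (if F.Accepts l k t y r₀ r₁ d m b then P.resp k r₀ r₁ m y d b else 0) ≤
      N * N * 2 * ((1 / 2 + Real.sqrt 2 / 4) * normSq (P.state₁ k y) + Real.sqrt 2 / 8 *
        if ∃ x ∈ F.dom l k, F.f l k x = y then F.quantumBias l P k t y else 0) := fun y => by
    by_cases hg : ∃ x ∈ F.dom l k, F.f l k x = y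
    · rw [if_pos hg, quantumBias, hcard]
      have h1 : ∀ r₀ r₁ : Bits (F.inLen l), ∑ d : Bits (F.inLen l), ∑ m : Bool, ∑ b : Bool,
          (if F.Accepts l k t y r₀ r₁ d m b then P.resp k r₀ r₁ m y d b else 0) ≤
          (1 + Real.sqrt 2 / 2) * normSq (P.state₁ k y) + Real.sqrt 2 / 4 *
            (parityChar (Sum.elim r₀ r₁) (F.invPair l t y) *
              ∑ d, (P.correlation (P.state₂ k r₀ r₁ y d)).re) := by
        intro r₀ r₁
        rw [← P.sum_normSq_state₂ k r₀ r₁ y, Finset.mul_sum, Finset.mul_sum, Finset.mul_sum,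
          ← Finset.sum_add_distrib]
        refine Finset.sum_le_sum fun d _ => ?_
        obtain ⟨c, hc, hc'⟩ := exists_correct_answer (F.Inv l t y).1 (F.Inv l t y).2 r₀ r₁ d
        rw [invPair, ← hc']
        simp only [Accepts, hc, hg, true_and, Finset.sum_ite_eq', Finset.mem_univ, if_true]
        exact P.sum_normSq_correct_le (P.state₂ k r₀ r₁ y d) c
      refine (Finset.sum_le_sum fun r₀ _ => Finset.sum_le_sum fun r₁ _ => h1 r₀ r₁).trans_eq ?_
      rw [← (Equiv.sumArrowEquivProdArrow (Fin (F.inLen l)) (Fin (F.inLen l)) Bool).symm.sum_comp,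
        Fintype.sum_prod_type]
      simp only [Finset.sum_add_distrib, ← Finset.mul_sum, Finset.sum_const, Finset.card_univ,
        Fintype.card_fun, Fintype.card_bool, Fintype.card_fin, nsmul_eq_mul, Nat.cast_pow,
        Nat.cast_ofNat, ← hN]
      have : ∀ r₀ r₁, (Equiv.sumArrowEquivProdArrow (Fin (F.inLen l)) (Fin (F.inLen l)) Bool).symm
          (r₀, r₁) = Sum.elim r₀ r₁ := fun _ _ => rfl
      simp only [this, Sum.elim_comp_inl, Sum.elim_comp_inr]
      field_simp
      ring
    · rw [if_neg hg]
      simp only [Accepts, hg, false_and, if_false, Finset.sum_const_zero]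
      have := normSq_nonneg (P.state₁ k y)
      positivity
  have hsum : ∑ r₀ : Bits (F.inLen l), ∑ r₁ : Bits (F.inLen l), ∑ m : Bool,
      ∑ y : Bits (F.imgLen l), ∑ d : Bits (F.inLen l), ∑ b : Bool,
        (if F.Accepts l k t y r₀ r₁ d m b then P.resp k r₀ r₁ m y d b else 0) =
      ∑ y, ∑ r₀ : Bits (F.inLen l), ∑ r₁ : Bits (F.inLen l), ∑ d : Bits (F.inLen l),
      ∑ m : Bool, ∑ b : Bool,
        (if F.Accepts l k t y r₀ r₁ d m b then P.resp k r₀ r₁ m y d b else 0) := by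
    symm
    rw [Finset.sum_comm]
    refine Finset.sum_congr rfl fun r₀ _ => ?_
    rw [Finset.sum_comm]
    refine Finset.sum_congr rfl fun r₁ _ => ?_
    symm
    rw [Finset.sum_comm]
    refine Finset.sum_congr rfl fun y _ => ?_
    rw [Finset.sum_comm]
  rw [hsum, div_le_iff₀ (by positivity)]
  refine (Finset.sum_le_sum fun y _ => hmsg y).trans_eq ?_
  rw [← Finset.mul_sum, Finset.sum_add_distrib, ← Finset.mul_sum, ← Finset.mul_sum,
    P.sum_normSq_state₁]
  ring

end FunFamily

/-! ## Extraction of the parity mask from a quantum prover -/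

namespace QuantumProver

variable {a v n : ℕ} (P : QuantumProver a v n)

/-- The wires added to those of the prover: a random string, and copies of the first two
messages. -/
abbrev ExtraWire (v n : ℕ) : Type := (Fin n ⊕ Fin n) ⊕ (Fin v ⊕ Fin n)

/-- The vector of the prover's wires for fixed values of the other wires. -/
def slice (ψ : QVec (P.Wire ⊕ ExtraWire v n)) (r : Fin n ⊕ Fin n → Bool) (y : Bits v)
    (d : Bits n) : QVec P.Wire :=
  fun u => ψ (Sum.elim u (Sum.elim r (Sum.elim y d)))

/-- A circuit on the prover's wires. -/
def lift (C : List (QGate P.Wire)) : List (QGate (P.Wire ⊕ ExtraWire v n)) :=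
  C.map (QGate.rename Function.Embedding.inl)

theorem slice_lift (C : List (QGate P.Wire)) (ψ : QVec (P.Wire ⊕ ExtraWire v n))
    (r : Fin n ⊕ Fin n → Bool) (y : Bits v) (d : Bits n) :
    P.slice (runQ (P.lift C) ψ) r y d = runQ C (P.slice ψ r y d) := by
  have h := slice_runQ (Function.Embedding.inl (α := P.Wire) (β := ExtraWire v n)) C ψ
    (Sum.elim (fun _ => false) (Sum.elim r (Sum.elim y d)))
  have hext : ∀ u : P.Wire → Bool, Function.extend
      (Function.Embedding.inl (α := P.Wire) (β := ExtraWire v n)) u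
      (Sum.elim (fun _ => false) (Sum.elim r (Sum.elim y d))) =
      Sum.elim u (Sum.elim r (Sum.elim y d)) := fun u => by
    funext w
    rcases w with w | w
    · exact Function.Embedding.inl.injective.extend_apply _ _ w
    · exact Function.extend_apply' _ _ _ (by simp)
  simp only [hext] at h
  exact h

/-- Copying the first message. -/
noncomputable def copyImg : List (QGate (P.Wire ⊕ ExtraWire v n)) :=
  (Finset.univ : Finset (Fin v)).toList.map fun i =>
    cnot (Sum.inl (.img i)) (Sum.inr (Sum.inr (Sum.inl i))) (by simp)

theorem slice_copyImg (ψ : QVec (P.Wire ⊕ ExtraWire v n)) (r : Fin n ⊕ Fin n → Bool) (y : Bits v)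
    (d : Bits n) (u : P.Wire → Bool) : P.slice (runQ P.copyImg ψ) r y d u =
      P.slice ψ r (fun i => xor (y i) (u (.img i))) d u := by
  refine runQ_copy (fun i : Fin v => (Sum.inl (.img i) : P.Wire ⊕ ExtraWire v n))
    (fun i => Sum.inr (Sum.inr (Sum.inl i))) (by simp) (fun i j h => by simpa using h) _
    (Finset.nodup_toList _) _ _ _ ?_ ?_
  · simp
  · rintro (w | w | w | w) hw
    · rfl
    · rfl
    · exact absurd rfl (hw w (by simp))
    · rfl

/-- Copying the second message. -/
noncomputable def copyD : List (QGate (P.Wire ⊕ ExtraWire v n)) :=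
  (Finset.univ : Finset (Fin n)).toList.map fun i =>
    cnot (Sum.inl (.d i)) (Sum.inr (Sum.inr (Sum.inr i))) (by simp)

theorem slice_copyD (ψ : QVec (P.Wire ⊕ ExtraWire v n)) (r : Fin n ⊕ Fin n → Bool) (y : Bits v)
    (d : Bits n) (u : P.Wire → Bool) : P.slice (runQ P.copyD ψ) r y d u =
      P.slice ψ r y (fun i => xor (d i) (u (.d i))) u := by
  refine runQ_copy (fun i : Fin n => (Sum.inl (.d i) : P.Wire ⊕ ExtraWire v n))
    (fun i => Sum.inr (Sum.inr (Sum.inr i))) (by simp) (fun i j h => by simpa using h) _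
    (Finset.nodup_toList _) _ _ _ ?_ ?_
  · simp
  · rintro (w | w | w | w) hw
    · rfl
    · rfl
    · rfl
    · exact absurd rfl (hw w (by simp))

/-- Adding the random string to the register of the verifier's second message. -/
noncomputable def copyR : List (QGate (P.Wire ⊕ ExtraWire v n)) :=
  (Finset.univ : Finset (Fin n ⊕ Fin n)).toList.map fun i =>
    cnot (Sum.inr (Sum.inl i)) (Sum.inl (Sum.elim .r₀ .r₁ i)) (by simp)

theorem slice_copyR (ψ : QVec (P.Wire ⊕ ExtraWire v n)) (r : Fin n ⊕ Fin n → Bool) (y : Bits v)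
    (d : Bits n) (u : P.Wire → Bool) : P.slice (runQ P.copyR ψ) r y d u =
      P.slice ψ r y d (ProverWire.loadR (r ∘ Sum.inl) (r ∘ Sum.inr) u) := by
  refine runQ_copy (fun i : Fin n ⊕ Fin n => (Sum.inr (Sum.inl i) : P.Wire ⊕ ExtraWire v n))
    (fun i => Sum.inl (Sum.elim .r₀ .r₁ i)) (by simp) ?_ _
    (Finset.nodup_toList _) _ _ _ ?_ ?_
  · rintro (i | i) (j | j) h <;> simp at h <;> exact congrArg _ h
  · rintro (i | i) _ <;> rfl
  · rintro (w | w) hw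
    · cases w with
      | r₀ i => exact absurd rfl (hw (Sum.inl i) (by simp))
      | r₁ i => exact absurd rfl (hw (Sum.inr i) (by simp))
      | _ => rfl
    · rfl

/-- Hadamard gates on the random string. -/
noncomputable def hadamards : List (QGate (P.Wire ⊕ ExtraWire v n)) :=
  (Finset.univ : Finset (Fin n ⊕ Fin n)).toList.map fun i =>
    hadamardGate (Sum.inr (Sum.inl i)) (Sum.inl .chal) (by simp)

theorem slice_hadamards (ψ : QVec (P.Wire ⊕ ExtraWire v n)) (x : Fin n ⊕ Fin n → Bool)
    (y : Bits v) (d : Bits n) (u : P.Wire → Bool) : P.slice (runQ P.hadamards ψ) x y d u =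
      hadamardScale ^ (n + n) * ∑ r, (parityChar r x : ℂ) * P.slice ψ r y d u := by
  let e : Fin n ⊕ Fin n ↪ P.Wire ⊕ ExtraWire v n :=
    Function.Embedding.inl.trans Function.Embedding.inr
  refine (runQ_hadamard e (Sum.inl .chal) (by simp [e]) _ (Finset.nodup_toList _) _ _).trans ?_
  simp only [Finset.length_toList, Finset.card_univ, Fintype.card_sum, Fintype.card_fin,
    Finset.mem_toList, Finset.mem_univ, not_true, IsEmpty.forall_iff, implies_true, if_true,
    Finset.prod_map_toList]
  congr 1
  refine Finset.sum_congr rfl fun r _ => ?_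
  congr 1
  · rw [parityChar]
    push_cast
    rfl
  · refine congrArg ψ (funext fun w => ?_)
    rcases w with w | w | w
    · exact Function.extend_apply' _ _ _ (by simp [e])
    · exact e.injective.extend_apply _ _ w
    · exact Function.extend_apply' _ _ _ (by simp [e])

/-- The circuit that extracts the parity mask. -/
noncomputable def extractor : List (QGate (P.Wire ⊕ ExtraWire v n)) :=
  -- Copying a message onto fresh wires plays the role of its measurement. The copy of `y` is kept,
  -- whereas `d` is copied a second time to erase its record before the second round is undone.
  P.hadamards ++ (P.lift P.round₁ ++ (P.copyImg ++ (P.copyR ++ (P.lift P.round₂ ++ (P.copyD ++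
    (P.lift (P.observable true ++ invQ (P.observable false)) ++ (P.copyD ++
      (P.lift (invQ P.round₂) ++ (P.copyR ++ P.hadamards)))))))))

theorem length_le_card_wire : v + (n + n + (n + 2)) ≤ Fintype.card P.Wire := by
  have h : Fintype.card (Fin v ⊕ (Fin n ⊕ Fin n) ⊕ Fin n ⊕ Unit ⊕ Unit) ≤ Fintype.card P.Wire := by
    refine Fintype.card_le_of_injective (Sum.elim ProverWire.img (Sum.elim
      (Sum.elim ProverWire.r₀ ProverWire.r₁) (Sum.elim ProverWire.d
        (Sum.elim (fun _ => ProverWire.chal) fun _ => ProverWire.ans)))) ?_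
    rintro (i | (i | i) | i | i | i) (j | (j | j) | j | j | j) h <;> simp_all
  simp only [Fintype.card_sum, Fintype.card_fin, Fintype.card_unit] at h
  exact h

theorem card_extraWire_le : Fintype.card (ExtraWire v n) ≤ P.size := by
  have h := P.length_le_card_wire
  simp only [Fintype.card_sum, Fintype.card_fin, size]
  have hW : Fintype.card P.Wire = Fintype.card (ProverWire a v n (Fin P.work)) := rfl
  omega

theorem length_extractor_le : P.extractor.length ≤ 20 * P.size := by
  have h := P.length_le_card_wire
  have hc : ∀ m, (P.challenge m).length ≤ 1 := fun m => by cases m <;> simp [challenge]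
  have h0 := hc false
  have h1 := hc true
  simp only [extractor, lift, hadamards, copyImg, copyR, copyD, observable, List.length_append,
    List.length_map, length_invQ, Finset.length_toList, Finset.card_univ, Fintype.card_sum,
    Fintype.card_fin, List.length_cons, size]
  have hW : Fintype.card P.Wire = Fintype.card (ProverWire a v n (Fin P.work)) := rfl
  omega

/-- The initial assignment of the extractor. -/
def extractorInit (k : Bits a) : P.Wire ⊕ ExtraWire v n → Bool :=
  Sum.elim (ProverWire.init k fun _ => false) fun _ => false

theorem slice_ket (k : Bits a) (r : Fin n ⊕ Fin n → Bool) (y : Bits v) (d : Bits n) :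
    P.slice (ket (P.extractorInit k)) r y d = fun u =>
      (if r = (fun _ => false) then 1 else 0) * (if y = (fun _ => false) then 1 else 0) *
        (if d = (fun _ => false) then 1 else 0) * ket (ProverWire.init k fun _ => false) u := by
  funext u
  have h : Sum.elim u (Sum.elim r (Sum.elim y d)) = P.extractorInit k ↔
      r = (fun _ => false) ∧ y = (fun _ => false) ∧ d = (fun _ => false) ∧
        u = ProverWire.init k fun _ => false := by
    constructor
    · intro h
      exact ⟨funext fun i => congrFun h (Sum.inr (Sum.inl i)),
        funext fun i => congrFun h (Sum.inr (Sum.inr (Sum.inl i))),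
        funext fun i => congrFun h (Sum.inr (Sum.inr (Sum.inr i))),
        funext fun i => congrFun h (Sum.inl i)⟩
    · rintro ⟨rfl, rfl, rfl, rfl⟩
      funext w
      rcases w with w | w | w | w <;> rfl
  simp only [slice, ket, h]
  split_ifs <;> simp_all

end QuantumProver

namespace QuantumProver

variable {a v n : ℕ} (P : QuantumProver a v n)

theorem xor_eq_false_iff {ι : Type*} (x y : ι → Bool) :
    (fun i => xor (x i) (y i)) = (fun _ => false) ↔ y = x := by
  constructor
  · intro h
    funext i
    have := congrFun h i
    simpa using (bne_eq_false_iff_eq.1 this).symm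
  · rintro rfl
    funext i
    simp

theorem parityChar_zero {R : Type*} [Fintype R] (x : R → Bool) :
    parityChar (fun _ => false) x = 1 := by
  simp [parityChar]

/-- The vector produced by the extractor. -/
noncomputable def extracted (k : Bits a) : QVec (P.Wire ⊕ ExtraWire v n) :=
  runQ P.extractor (ket (P.extractorInit k))

/-- The amplitude of `ψ_y`, the state of the prover after the first message, in the final vector
of the extractor. -/
theorem ip_state₁_extracted (k : Bits a) (x : Fin n ⊕ Fin n → Bool) (y : Bits v) :
    ip (P.state₁ k y) (P.slice (P.extracted k) x y fun _ => false) =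
      (∑ r, (parityChar r x : ℂ) *
        ∑ d, P.correlation (P.state₂ k (r ∘ Sum.inl) (r ∘ Sum.inr) y d)) / 2 ^ (n + n) := by
  set κ : ℂ := hadamardScale ^ (n + n) with hκ
  have hκκ : κ * κ = 1 / 2 ^ (n + n) := by
    rw [hκ, ← mul_pow, hadamardScale_mul_self, one_div_pow]
  rw [extracted, extractor]
  simp only [runQ_append]
  set S₀ := ket (P.extractorInit k) with hS₀
  -- All strings `r` now have the same amplitude `κ`.
  have h1 : ∀ r y d, P.slice (runQ P.hadamards S₀) r y d = fun u =>
      (κ * (if y = (fun _ => false) then 1 else 0) * (if d = (fun _ => false) then 1 else 0)) *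
        ket (ProverWire.init k fun _ => false) u := fun r y d => by
    funext u
    rw [slice_hadamards, Finset.sum_eq_single fun _ => false]
    · rw [slice_ket, parityChar_zero]
      simp only [if_true]
      push_cast
      ring
    · intro r' _ hr'
      rw [slice_ket]
      simp [hr']
    · simp
  generalize runQ P.hadamards S₀ = S₁ at *
  have h2 : ∀ r y d, P.slice (runQ (P.lift P.round₁) S₁) r y d = fun u =>
      (κ * (if y = (fun _ => false) then 1 else 0) * (if d = (fun _ => false) then 1 else 0)) *
        runQ P.round₁ (ket (ProverWire.init k fun _ => false)) u := fun r y d => by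
    rw [slice_lift, h1, runQ_smul]
  generalize runQ (P.lift P.round₁) S₁ = S₂ at *
  -- The copy register started at zero, so its slice at `y` is the projection on the message `y`.
  have h3 : ∀ r y d, P.slice (runQ P.copyImg S₂) r y d = fun u =>
      (κ * (if d = (fun _ => false) then 1 else 0)) * P.state₁ k y u := fun r y d => by
    funext u
    rw [slice_copyImg, h2]
    simp only [xor_eq_false_iff, state₁, project]
    by_cases hy : (fun j => u (ProverWire.img j)) = y
    · simp [hy]
    · simp [hy]
  generalize runQ P.copyImg S₂ = S₃ at *
  have h4 : ∀ r y d, P.slice (runQ P.copyR S₃) r y d = fun u =>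
      (κ * (if d = (fun _ => false) then 1 else 0)) *
        P.state₁ k y (ProverWire.loadR (r ∘ Sum.inl) (r ∘ Sum.inr) u) := fun r y d => by
    funext u
    rw [slice_copyR, h3]
  generalize runQ P.copyR S₃ = S₄ at *
  have h5 : ∀ r y d, P.slice (runQ (P.lift P.round₂) S₄) r y d = fun u =>
      (κ * (if d = (fun _ => false) then 1 else 0)) * runQ P.round₂ (fun u =>
        P.state₁ k y (ProverWire.loadR (r ∘ Sum.inl) (r ∘ Sum.inr) u)) u := fun r y d => by
    rw [slice_lift, h4, runQ_smul]
  generalize runQ (P.lift P.round₂) S₄ = S₅ at *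
  have h6 : ∀ r y d, P.slice (runQ P.copyD S₅) r y d = fun u =>
      κ * P.state₂ k (r ∘ Sum.inl) (r ∘ Sum.inr) y d u := fun r y d => by
    funext u
    rw [slice_copyD, h5]
    simp only [xor_eq_false_iff, state₂, project]
    by_cases hd : (fun j => u (ProverWire.d j)) = d
    · simp [hd]
    · simp [hd]
  generalize runQ P.copyD S₅ = S₆ at *
  let G : (Fin n ⊕ Fin n → Bool) → Bits n → QVec P.Wire := fun r d =>
    runQ (P.observable true ++ invQ (P.observable false))
      (P.state₂ k (r ∘ Sum.inl) (r ∘ Sum.inr) y d)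
  have h7 : ∀ r d, P.slice (runQ (P.lift (P.observable true ++ invQ (P.observable false))) S₆) r y d
      = fun u => κ * G r d u := fun r d => by
    rw [slice_lift, h6, runQ_smul]
  generalize runQ (P.lift (P.observable true ++ invQ (P.observable false))) S₆ = S₇ at *
  -- A zero record after the second copy selects the part where the register still holds the
  -- recorded `d`. It suffices, because `state₂` is supported there.
  have h8 : ∀ r, P.slice (runQ P.copyD S₇) r y (fun _ => false) = fun u =>
      κ * G r (fun i => u (.d i)) u := fun r => by
    funext u
    rw [slice_copyD, h7]
    simp
  generalize runQ P.copyD S₇ = S₈ at *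
  have h9 : ∀ r, ip (P.state₁ k y) (P.slice (runQ P.copyR (runQ (P.lift (invQ P.round₂)) S₈)) r y
      fun _ => false) = κ * ∑ d, P.correlation (P.state₂ k (r ∘ Sum.inl) (r ∘ Sum.inr) y d) := by
    intro r
    -- The undone second round is moved to the left of the inner product, where it becomes the
    -- second round applied to `ψ_y`; restricting this vector to each `d` gives `state₂`.
    let φ : QVec P.Wire := runQ P.round₂ fun s =>
      P.state₁ k y (ProverWire.loadR (r ∘ Sum.inl) (r ∘ Sum.inr) s)
    have hload : ∀ ψ : QVec P.Wire,
        ip (P.state₁ k y) (fun s => ψ (ProverWire.loadR (r ∘ Sum.inl) (r ∘ Sum.inr) s)) =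
        ip (fun s => P.state₁ k y (ProverWire.loadR (r ∘ Sum.inl) (r ∘ Sum.inr) s)) ψ :=
      fun ψ => by
        rw [← ip_comp_perm (ProverWire.loadRPerm r) (P.state₁ k y)]
        simp only [ProverWire.loadRPerm_apply, ProverWire.loadR_loadR]
    have hs : P.slice (runQ P.copyR (runQ (P.lift (invQ P.round₂)) S₈)) r y (fun _ => false) =
        fun s => runQ (invQ P.round₂) (fun u => κ * G r (fun i => u (.d i)) u)
          (ProverWire.loadR (r ∘ Sum.inl) (r ∘ Sum.inr) s) := by
      funext u
      rw [slice_copyR, slice_lift, h8]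
    rw [hs, hload, ip_runQ_invQ, ip_smul_right]
    congr 1
    have hG : ∀ d, P.correlation (P.state₂ k (r ∘ Sum.inl) (r ∘ Sum.inr) y d) =
        ip (P.state₂ k (r ∘ Sum.inl) (r ∘ Sum.inr) y d) (G r d) := fun d => by
      simp only [G]
      rw [runQ_append, ip_runQ_invQ, correlation]
    simp only [hG, ip]
    rw [Finset.sum_comm]
    refine Finset.sum_congr rfl fun s _ => ?_
    rw [Finset.sum_eq_single fun i => s (.d i)]
    · simp [state₂, project]
    · intro d _ hd
      simp [state₂, project, hd.symm]
    · simp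
  have h10 : P.slice (runQ P.hadamards (runQ P.copyR (runQ (P.lift (invQ P.round₂)) S₈))) x y
      (fun _ => false) = fun u => κ * ∑ r, (parityChar r x : ℂ) *
        P.slice (runQ P.copyR (runQ (P.lift (invQ P.round₂)) S₈)) r y (fun _ => false) u := by
    funext u
    rw [slice_hadamards]
  rw [h10, ip_smul_right, ip_sum_right]
  simp only [ip_smul_right, h9]
  -- The two layers of Hadamard gates contribute one factor `κ` each.
  rw [div_eq_mul_one_div, ← hκκ, Finset.mul_sum, Finset.sum_mul]
  exact Finset.sum_congr rfl fun r _ => by ring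

/-- The probability of an output of the extractor, bounded below by slices. -/
theorem sum_slice_le (ψ : QVec (P.Wire ⊕ ExtraWire v n)) (x : Fin n ⊕ Fin n → Bool) :
    ∑ y, normSq (P.slice ψ x y fun _ => false) ≤
      normSq (project (fun i => Sum.inr (Sum.inl i)) x ψ) := by
  have h : normSq (project (fun i => Sum.inr (Sum.inl i)) x ψ) =
      ∑ e : ExtraWire v n → Bool, ∑ u : P.Wire → Bool,
        ‖project (fun i => Sum.inr (Sum.inl i)) x ψ (Sum.elim u e)‖ ^ 2 := by
    rw [Finset.sum_comm, ← Fintype.sum_prod_type', normSq,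
      ← Equiv.sum_comp (Equiv.sumArrowEquivProdArrow _ _ _).symm]
    rfl
  rw [h]
  have hinj : Function.Injective fun y : Bits v =>
      (Sum.elim x (Sum.elim y fun _ => false) : ExtraWire v n → Bool) := fun y y' h =>
    funext fun i => congrFun h (Sum.inr (Sum.inl i))
  have hslice : ∀ y, normSq (P.slice ψ x y fun _ => false) = ∑ u : P.Wire → Bool,
      ‖project (fun i => Sum.inr (Sum.inl i)) x ψ
        (Sum.elim u (Sum.elim x (Sum.elim y fun _ => false)))‖ ^ 2 := fun y =>
    Finset.sum_congr rfl fun u _ => by simp [slice, project]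
  simp only [hslice]
  rw [← Finset.sum_image (f := fun e : ExtraWire v n → Bool => ∑ u : P.Wire → Bool,
      ‖project (fun i => Sum.inr (Sum.inl i)) x ψ (Sum.elim u e)‖ ^ 2) hinj.injOn]
  exact Finset.sum_le_sum_of_subset_of_nonneg (Finset.subset_univ _) fun e _ _ =>
    Finset.sum_nonneg fun u _ => sq_nonneg _

end QuantumProver

/-! ### Quantum soundness from the extractor -/

namespace FunFamily

variable (F : FunFamily)

theorem quantumBias_le (l : ℕ) (P : QuantumProver (F.keyLen l) (F.imgLen l) (F.inLen l))
    (k : Bits (F.keyLen l)) (t : Bits (F.tdLen l)) (y : Bits (F.imgLen l)) (c : ℝ) :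
    2 * c * F.quantumBias l P k t y ≤ c ^ 2 * normSq (P.state₁ k y) +
      normSq (P.slice (P.extracted k) (F.invPair l t y) y fun _ => false) := by
  have h : F.quantumBias l P k t y =
      (ip (P.state₁ k y) (P.slice (P.extracted k) (F.invPair l t y) y fun _ => false)).re := by
    rw [P.ip_state₁_extracted, quantumBias, Fintype.card_sum, Fintype.card_fin]
    have h2 : ((2 : ℂ) ^ (F.inLen l + F.inLen l)) =
        ((2 ^ (F.inLen l + F.inLen l) : ℝ) : ℂ) := by push_cast; rfl
    rw [h2, Complex.div_ofReal_re, Complex.re_sum]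
    simp only [Complex.re_ofReal_mul, Complex.re_sum]
  rw [h]
  exact two_mul_re_ip_le _ _ c

/-- The slices for distinct `y` are orthogonal parts of the final vector, so their squared norms add
up to at most the probability of the output, and the squared norms of the `ψ_y` add up to `1`. Hence
`quantumBias_le` can be summed over `y` with one common constant. -/
theorem exists_alg_sq_quantumAdvantage_le (hF : F.TrapdoorInjectivePair) (l : ℕ)
    (P : QuantumProver (F.keyLen l) (F.imgLen l) (F.inLen l)) :
    ∃ A : QuantumAlg (Fin (F.keyLen l)) (Fin (F.inLen l) ⊕ Fin (F.inLen l)),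
      A.size ≤ 24 * P.size ∧ F.quantumAdvantage l P ^ 2 ≤ F.clawProb l A.prob := by
  classical
  obtain ⟨A, hsize, hA⟩ := exists_quantumAlg
    (fun i => (Sum.inl (.key i) : P.Wire ⊕ QuantumProver.ExtraWire (F.imgLen l) (F.inLen l)))
    (fun i => Sum.inr (Sum.inl i)) (by rintro (i | i) (j | j) h <;> simp_all) P.extractor
  have hprob : ∀ k z, A.prob k z =
      normSq (project (fun i => Sum.inr (Sum.inl i)) z (P.extracted k)) := fun k z => by
    refine hA k z (P.extractorInit k) (fun i => rfl) ?_
    rintro (w | w) hw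
    · cases w with
      | key i => exact absurd rfl (hw i)
      | _ => rfl
    · rfl
  refine ⟨A, ?_, ?_⟩
  · rw [hsize]
    have h := P.length_extractor_le
    have hc := P.card_extraWire_le
    rw [Fintype.card_sum]
    have hW : Fintype.card P.Wire ≤ P.size := Nat.le_add_right _ _
    omega
  -- The choice of `ε` as the advantage itself gives the square.
  suffices h : ∀ ε, 2 * ε * F.quantumAdvantage l P ≤ ε ^ 2 + F.clawProb l A.prob by
    have := h (F.quantumAdvantage l P)
    nlinarith
  intro ε
  rw [clawProb_eq, quantumAdvantage, ← F.genAvg_const l (ε ^ 2), ← F.genAvg_const_mul, ← F.genAvg_add]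
  refine F.genAvg_mono fun k t hkt => ?_
  have h1 : ∑ y, F.clawProbAt l k (fun z => normSq (P.slice (P.extracted k) z y fun _ => false)) ≤
      F.clawProbAt l k (A.prob k) := by
    rw [← clawProbAt_sum]
    refine Finset.sum_le_sum fun x₀ _ => Finset.sum_le_sum fun x₁ _ => ?_
    split_ifs
    · rw [hprob]
      exact P.sum_slice_le _ _
    · rfl
  refine le_trans ?_ (add_le_add_right h1 _)
  have h2 : ε ^ 2 = ∑ y, ε ^ 2 * normSq (P.state₁ k y) := by
    rw [← Finset.mul_sum, P.sum_normSq_state₁, mul_one]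
  rw [Finset.mul_sum]
  conv_rhs => rw [h2, ← Finset.sum_add_distrib]
  refine Finset.sum_le_sum fun y _ => ?_
  split_ifs with hg
  · refine (F.quantumBias_le l P k t y ε).trans (add_le_add_right ?_ _)
    exact F.le_clawProbAt (fun z => normSq_nonneg (P.slice (P.extracted k) z y fun _ => false))
      (isClaw_inv hF hkt hg)
  · rw [mul_zero]
    exact add_nonneg (mul_nonneg (sq_nonneg _) (normSq_nonneg _))
      (F.clawProbAt_nonneg fun z => normSq_nonneg _)

theorem quantum_soundness (hF : F.IsTCF .quantum)
    (P : ∀ l, QuantumProver (F.keyLen l) (F.imgLen l) (F.inLen l))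
    (hP : PolyBounded fun l => (P l).size) :
    ∃ ν : ℕ → ℝ, Negligible ν ∧
      ∀ l, F.acceptProb l (P l).resp ≤ Real.cos (Real.pi / 8) ^ 2 + ν l := by
  choose A hsize hA using fun l => F.exists_alg_sq_quantumAdvantage_le hF.trapdoorInjectivePair l (P l)
  have hclaw : Negligible fun l => F.clawProb l (A l).prob :=
    hF.clawFree A (((PolyBounded.const 24).mul hP).mono hsize)
  -- The advantage may be negative, so its absolute value is used.
  have hadv : Negligible fun l => |F.quantumAdvantage l (P l)| :=
    hclaw.of_sq_le (fun l => abs_nonneg _) fun l => by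
      rw [sq_abs]
      exact hA l
  refine ⟨_, hadv.const_mul (by positivity : 0 ≤ Real.sqrt 2 / 8), fun l => ?_⟩
  have hcos : Real.cos (Real.pi / 8) ^ 2 = 1 / 2 + Real.sqrt 2 / 4 := by
    rw [Real.cos_sq, show 2 * (Real.pi / 8) = Real.pi / 4 by ring, Real.cos_pi_div_four]
    ring
  rw [hcos]
  refine (F.acceptProb_quantum_le l (P l)).trans ?_
  gcongr
  exact le_abs_self _

end FunFamily

theorem theorem4 (F : FunFamily) :
    (F.IsTCF Security.classical →
      ∀ P : ∀ l, ClassicalProver (F.keyLen l) (F.imgLen l) (F.inLen l),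
        PolyBounded (fun l => (P l).size) →
          ∃ ν : ℕ → ℝ, Negligible ν ∧ ∀ l, F.acceptProb l (P l).resp ≤ 3 / 4 + ν l) ∧
    (F.IsTCF Security.quantum →
      ∀ P : ∀ l, QuantumProver (F.keyLen l) (F.imgLen l) (F.inLen l),
        PolyBounded (fun l => (P l).size) →
          ∃ ν : ℕ → ℝ, Negligible ν ∧
            ∀ l, F.acceptProb l (P l).resp ≤ Real.cos (Real.pi / 8) ^ 2 + ν l) :=
  ⟨F.classical_soundness, F.quantum_soundness⟩
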